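/- Let $n\ge 1$ and let $\sigma$ be a probability distribution on $[n]=\{1,\dots,n\}$. Write $\sigma_{\le i}:=\Pr_{i^*\sim\sigma}[i^*\le i]$. The $\sigma$-MultiQueue is the following random process. The elements of an infinite set $\{x_1<x_2<x_3<\dots\}$ are put, independently and uniformly at random, into $n$ queues. At all times the queues are labelled $Q_1,\dots,Q_n$ such that their minima, called the top-elements, are in ascending order: $\min Q_1<\dots<\min Q_n$. In each step, an index $i\in[n]$ is drawn according to $\sigma$ (independently of everything else), the top-element of $Q_i$ is deleted, and the queues are relabelled such that the top-elements are in ascending order again. Let $Q_1^{(s)},\dots,Q_n^{(s)}$ be the queues after $s$ deletions, and let $r_i^{(s)}$ be the rank of $\min Q_i^{(s)}$ among the elements of $Q_1^{(s)}\cup\dots\cup Q_n^{(s)}$. **Theorem 1.** Suppose that $$\sigma_{\le i}>\frac in\quad\text{for all } i\in[n-1].\tag{☆}$$ Then $(r_1^{(s)},\dots,r_n^{(s)})$ converges in distribution, as $s\to\infty$, to a sequence $(r_1,\dots,r_n)$ of random variables with $$r_i=1+\sum_{j=1}^{i-1}\delta_j\quad (i\in[n]),$$ where $\delta_1,\dots,\delta_{n-1}$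 are independent and $\delta_j\sim\mathrm{Geom}_1\Big(1-\dfrac{j}{n\,\sigma_{\le j}}\Big)$ for $j\in[n-1]$. Here $\mathrm{Geom}_1(p)$ is the distribution of the number of independent Bernoulli trials with success probability $p$ until and including the first success. -/

import Mathlib

open MeasureTheory ProbabilityTheory Filter

noncomputable section

namespace SigmaMultiQueue

/-- `σ_{≤ i}`, the probability that an index chosen according to `σ` is among the first `i` ones.
The index set `{1, …, n}` is represented by `Fin n`, so the first `i` indices are those whose
value is less than `i`. -/
def cumul {n : ℕ} (σ : PMF (Fin n)) (i : ℕ) : ℝ :=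
  ∑ k : Fin n with k.val < i, (σ k).toReal

/-- The condition `(☆)`: `σ_{≤ i} > i / n` for all `i ∈ {1, …, n - 1}`. -/
def Star {n : ℕ} (σ : PMF (Fin n)) : Prop :=
  ∀ i : ℕ, 1 ≤ i → i < n → (i : ℝ) / n < cumul σ i

/-- The geometric distribution `Geom₁(p)` of the number of Bernoulli trials with success
probability `p` until and including the first success (Mathlib's `geometricMeasure` counts the
failures only). -/
def geomOne (p : unitInterval) : Measure ℕ :=
  (geometricMeasure p).map (fun k => k + 1)

section Dynamics

variable {α : Type*} [LinearOrder α]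

/-- The top-element (the minimum) of a queue `Q ⊆ {x 0 < x 1 < …}`. -/
def topElem (x : ℕ → α) (Q : Set α) : α :=
  x (sInf {k | x k ∈ Q})

/-- For strictly increasing `x`, the top-element of a nonempty queue is its least element. -/
theorem topElem_isLeast {x : ℕ → α} (hx : StrictMono x) {Q : Set α} (hQ : Q ⊆ Set.range x)
    (hne : Q.Nonempty) : IsLeast Q (topElem x Q) := by
  obtain ⟨y, hy⟩ := hne
  obtain ⟨k, rfl⟩ := hQ hy
  refine ⟨Nat.sInf_mem (s := {k | x k ∈ Q}) ⟨k, hy⟩, fun z hz => ?_⟩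
  obtain ⟨m, rfl⟩ := hQ hz
  exact hx.monotone (Nat.sInf_le hz)

/-- Relabel the queues such that their top-elements appear in ascending order. -/
def relabel {n : ℕ} (x : ℕ → α) (Q : Fin n → Set α) : Fin n → Set α :=
  fun i => Q (Tuple.sort (fun q => topElem x (Q q)) i)

/-- Delete the top-element of the `i`-th queue, leaving the other queues unchanged. -/
def deleteTop {n : ℕ} (x : ℕ → α) (Q : Fin n → Set α) (i : Fin n) : Fin n → Set α :=
  Function.update Q i (Q i \ {topElem x (Q i)})

/-- The labelled queues `(Q₁^{(s)}, …, Qₙ^{(s)})` after `s` deletions, where element `x k` was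
initially put into the queue `a k`, and `c t` is the index chosen for the deletion number
`t + 1`. -/
def queues {n : ℕ} (x : ℕ → α) (a c : ℕ → Fin n) : ℕ → Fin n → Set α
  | 0 => relabel x (fun q => {y | ∃ k, a k = q ∧ x k = y})
  | s + 1 => relabel x (deleteTop x (queues x a c s) (c s))

/-- The rank of the top-element of the `i`-th queue among all elements of all queues. -/
def rank {n : ℕ} (x : ℕ → α) (Q : Fin n → Set α) (i : Fin n) : ℕ :=
  Set.ncard {y | y ∈ (⋃ q, Q q) ∧ y ≤ topElem x (Q i)}

end Dynamics

end SigmaMultiQueue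

end

open SigmaMultiQueue

/-!
The elements that remain after some deletions, in ascending order, form an infinite word over the
alphabet of queue names. The names given to the queues at the beginning are kept throughout. The
queue labelled `i` (counted from `0`) is the one whose name is the `i`-th to occur in the word, the
rank of its top-element is the position of this first occurrence (`exists_rank_queues`), and a
deletion removes the letter at this position. A *full* word is one in which all letters occur. A
full word `u` of length `L` is a prefix of the word after `s` deletions if the `s` deletions turn
the first `L + s` letters of the initial word into `u`, so only finitely many random variables
matter and infinite words need not be formalized.

*One step.* The word starts with the full word `u` after a deletion if and only if it started with
a word obtained from `u` by inserting some letter `q` before the first `q` of `u`, and if the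
choice was the number of distinct letters before the inserted one (`ite_del_eq`). So the
probabilities `wordProb σ s u` of these prefixes evolve by a positive linear operator `stepOp σ`.

*The stationary state.* Generate a random word such that, after `j` distinct letters, each old
letter comes with probability `1 / (n σ_{≤ j})`, and all new letters are equally likely. A short
induction on the word shows that the prefix probabilities `statWord σ` are fixed by `stepOp σ`
(`insSum_wt`). In this random word the gaps between the first occurrences of letters are
independent and geometrically distributed, with parameters that are positive by `(☆)`
(`fullSum_mask`, `maskWeight_gapMask`).

*Convergence.* The initial state has a bounded density with respect to the stationary one, since
`1 / n ≤ 1 / (n σ_{≤ j})`, and this bound is preserved. The squared `L²`-norm of the density is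
nonincreasing by Jensen's inequality, so the loss in each step tends to `0`
(`Star.sq_sub_le_energy`). As the least element is deleted with positive probability, the density
of `q :: u` after `s` steps and the one of `u` after `s + 1` steps approach each other. The density
of `v ++ u` equals the one of `v` if `v` is full. So the densities of any two full words of the same
length approach each other, and by conservation of mass they tend to `1` (`Star.tendsto_density`).
Hence the probability of each gap vector is asymptotically at least the stationary one, which
implies convergence in distribution as the stationary probabilities add up to `1`.
-/

namespace SigmaMultiQueue

open Finset
open scoped Topology

variable {n : ℕ}

/-! ### Words and weights -/

/-- Every letter occurs in `S` or in the word `u`. -/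
def Full : Finset (Fin n) → List (Fin n) → Prop
  | S, [] => S = univ
  | S, a :: u => Full (insert a S) u

/-- The sum of `F u` over the words `u` of length `L` such that every letter occurs in `S` or
in `u`. -/
def fullSum : ℕ → Finset (Fin n) → (List (Fin n) → ℝ) → ℝ
  | 0, S, F => if S = univ then F [] else 0
  | L + 1, S, F => ∑ a, fullSum L (insert a S) fun u => F (a :: u)

/-- The sum of `H j w` over all words `w` that arise from `u` by inserting a letter `q` somewhere
before the first occurrence of `q` in `u`, where `j` is the number of distinct letters in `S` and
in the part of `w` before the inserted letter. -/
def insSum (q : Fin n) : Finset (Fin n) → List (Fin n) → (ℕ → List (Fin n) → ℝ) → ℝ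
  | _, [], _ => 0
  | S, a :: u, H => H S.card (q :: a :: u) +
      if a = q then 0 else insSum q (insert a S) u fun j w => H j (a :: w)

/-- The weight of a word read after the letters in `S` have been seen: a letter contributes `x j`
if it has been seen before and `y j` if it is new, where `j` is the number of distinct letters
seen before it. -/
def wt (x y : ℕ → ℝ) : Finset (Fin n) → List (Fin n) → ℝ
  | _, [] => 1
  | S, a :: u => if a ∈ S then x S.card * wt x y S u else y S.card * wt x y (insert a S) u

theorem full_iff {S : Finset (Fin n)} {u : List (Fin n)} :
    Full S u ↔ ∀ a, a ∈ S ∨ a ∈ u := by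
  induction u generalizing S with
  | nil => simp [Full, Finset.eq_univ_iff_forall]
  | cons b u ih =>
    simp only [Full, ih, mem_insert, List.mem_cons]
    exact forall_congr' fun a => by tauto

theorem Full.mono {S T : Finset (Fin n)} {u v : List (Fin n)} (h : Full S u) (hST : S ⊆ T)
    (huv : u ⊆ v) : Full T v :=
  full_iff.2 fun a => (full_iff.1 h a).imp (fun h => hST h) (fun h => huv h)

theorem card_lt_of_notMem {S : Finset (Fin n)} {q : Fin n} (hq : q ∉ S) : S.card < n := by
  simpa using Finset.card_lt_univ_of_notMem hq

/-! ### Sums over words -/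

theorem fullSum_mono {L : ℕ} {S : Finset (Fin n)} {F G : List (Fin n) → ℝ}
    (h : ∀ u, u.length = L → Full S u → F u ≤ G u) : fullSum L S F ≤ fullSum L S G := by
  induction L generalizing S F G with
  | zero =>
    simp only [fullSum]
    split_ifs with hS
    · exact h [] rfl hS
    · exact le_rfl
  | succ L ih =>
    exact Finset.sum_le_sum fun a _ => ih fun u hu hf => h (a :: u) (by simp [hu]) hf

theorem fullSum_congr {L : ℕ} {S : Finset (Fin n)} {F G : List (Fin n) → ℝ}
    (h : ∀ u, u.length = L → Full S u → F u = G u) : fullSum L S F = fullSum L S G :=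
  le_antisymm (fullSum_mono fun u hu hf => (h u hu hf).le)
    (fullSum_mono fun u hu hf => (h u hu hf).ge)

theorem fullSum_const_mul (L : ℕ) (S : Finset (Fin n)) (c : ℝ) (F : List (Fin n) → ℝ) :
    fullSum L S (fun u => c * F u) = c * fullSum L S F := by
  induction L generalizing S F with
  | zero => simp [fullSum]
  | succ L ih => simp only [fullSum, ih, Finset.mul_sum]

theorem fullSum_add (L : ℕ) (S : Finset (Fin n)) (F G : List (Fin n) → ℝ) :
    fullSum L S (fun u => F u + G u) = fullSum L S F + fullSum L S G := by
  induction L generalizing S F G with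
  | zero => simp only [fullSum]; split_ifs <;> simp
  | succ L ih => simp only [fullSum, ih, Finset.sum_add_distrib]

theorem fullSum_sub (L : ℕ) (S : Finset (Fin n)) (F G : List (Fin n) → ℝ) :
    fullSum L S (fun u => F u - G u) = fullSum L S F - fullSum L S G := by
  have := fullSum_add L S (fun u => F u - G u) G
  simp only [sub_add_cancel] at this
  linarith

theorem fullSum_zero (L : ℕ) (S : Finset (Fin n)) : fullSum L S (fun _ => 0) = 0 := by
  simpa using fullSum_const_mul L S 0 fun _ => 0

theorem fullSum_nonneg {L : ℕ} {S : Finset (Fin n)} {F : List (Fin n) → ℝ}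
    (h : ∀ u, Full S u → 0 ≤ F u) : 0 ≤ fullSum L S F :=
  (fullSum_zero L S).symm.trans_le (fullSum_mono fun u _ hf => h u hf)

theorem fullSum_sum {ι : Type*} (s : Finset ι) (L : ℕ) (S : Finset (Fin n))
    (F : ι → List (Fin n) → ℝ) :
    fullSum L S (fun u => ∑ i ∈ s, F i u) = ∑ i ∈ s, fullSum L S (F i) := by
  classical
  induction s using Finset.induction_on with
  | empty => simp [fullSum_zero]
  | insert i s hi ih => simp only [Finset.sum_insert hi, fullSum_add, ih]

theorem fullSum_mono_set {L : ℕ} {S T : Finset (Fin n)} (hST : S ⊆ T) {F : List (Fin n) → ℝ}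
    (h : ∀ u, Full T u → 0 ≤ F u) : fullSum L S F ≤ fullSum L T F := by
  induction L generalizing S T F with
  | zero =>
    simp only [fullSum]
    split_ifs with h1 h2 h2
    · exact le_rfl
    · exact absurd (univ_subset_iff.1 (h1 ▸ hST)) h2
    · exact h [] h2
    · exact le_rfl
  | succ L ih =>
    exact Finset.sum_le_sum fun a _ => ih (insert_subset_insert a hST) fun u hu => h (a :: u) hu

/-- `F` is the density of an ultimately uniform measure on infinite words: once all letters have
been seen, all letters are equally likely to come next. -/
def UniformTail (S : Finset (Fin n)) (F : List (Fin n) → ℝ) : Prop :=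
  ∀ u a, Full S u → F (u ++ [a]) = F u / n

theorem UniformTail.cons {S : Finset (Fin n)} {F : List (Fin n) → ℝ} (h : UniformTail S F)
    (a : Fin n) : UniformTail (insert a S) fun u => F (a :: u) :=
  fun u b hu => h (a :: u) b hu

theorem UniformTail.append {S : Finset (Fin n)} {F : List (Fin n) → ℝ} (h : UniformTail S F)
    {u : List (Fin n)} (hu : Full S u) (v : List (Fin n)) :
    F (u ++ v) = F u / n ^ v.length := by
  induction v using List.reverseRecOn with
  | nil => simp
  | append_singleton v a ih =>
    rw [← List.append_assoc, h _ a (hu.mono subset_rfl (List.subset_append_left u v)), ih]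
    simp [pow_succ, div_div]

theorem fullSum_le_succ [NeZero n] {L : ℕ} {S : Finset (Fin n)} {F : List (Fin n) → ℝ}
    (hF : UniformTail S F) (h : ∀ u, Full S u → 0 ≤ F u) :
    fullSum L S F ≤ fullSum (L + 1) S F := by
  have hn : (n : ℝ) ≠ 0 := NeZero.ne _
  induction L generalizing S F with
  | zero =>
    by_cases hS : S = univ
    · subst hS
      have : ∀ a, F [a] = F [] / n := fun a => hF [] a rfl
      simp [fullSum, this, mul_div_cancel₀ _ hn]
    · rw [fullSum, if_neg hS]
      exact fullSum_nonneg h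
  | succ L ih =>
    exact Finset.sum_le_sum fun a _ => ih (hF.cons a) fun u hu => h (a :: u) hu

theorem fullSum_univ_of_uniformTail [NeZero n] (L : ℕ) {F : List (Fin n) → ℝ}
    (hF : UniformTail univ F) : fullSum L univ F = F [] := by
  have hn : (n : ℝ) ≠ 0 := NeZero.ne _
  induction L generalizing F with
  | zero => simp [fullSum]
  | succ L ih =>
    have : ∀ a, F [a] = F [] / n := fun a => hF [] a rfl
    have h2 : ∀ a, UniformTail univ fun u => F (a :: u) := fun a => by
      simpa using hF.cons a
    simp only [fullSum, insert_eq_of_mem (mem_univ _), ih (h2 _), this]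
    simp [mul_div_cancel₀ _ hn]

/-- The words that extend a given full word `u` contribute at most the whole sum. -/
theorem fullSum_append_le {K : ℕ} {S : Finset (Fin n)} {u : List (Fin n)} (hu : Full S u)
    {F : List (Fin n) → ℝ} (h : ∀ v, Full S v → 0 ≤ F v) :
    fullSum K univ (fun v => F (u ++ v)) ≤ fullSum (u.length + K) S F := by
  induction u generalizing S F with
  | nil =>
    have hS : S = univ := hu
    simp [hS]
  | cons a u ih =>
    have h1 : (a :: u).length + K = (u.length + K) + 1 := by simp; omega
    rw [h1, fullSum]
    refine (ih (S := insert a S) hu (F := fun v => F (a :: v)) fun v hv => h _ hv).trans ?_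
    exact Finset.single_le_sum
      (f := fun b => fullSum (u.length + K) (insert b S) fun v => F (b :: v))
      (fun b _ => fullSum_nonneg fun v hv => h (b :: v) hv) (mem_univ a)

/-! ### Insertions -/

theorem insSum_mono {q : Fin n} {S : Finset (Fin n)} {u : List (Fin n)}
    {H H' : ℕ → List (Fin n) → ℝ} (hu : Full S u)
    (h : ∀ j w, w.length = u.length + 1 → Full S w → H j w ≤ H' j w) :
    insSum q S u H ≤ insSum q S u H' := by
  induction u generalizing S H H' with
  | nil => exact le_rfl
  | cons a u ih =>
    simp only [insSum]
    refine add_le_add (h _ _ rfl (hu.mono (subset_refl S) (List.subset_cons_self q (a :: u)))) ?_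
    split_ifs
    · exact le_rfl
    · exact ih (S := insert a S) hu fun j w hl hw => h j (a :: w) (by simp [hl]) hw

theorem insSum_congr {q : Fin n} {S : Finset (Fin n)} {u : List (Fin n)}
    {H H' : ℕ → List (Fin n) → ℝ} (hu : Full S u)
    (h : ∀ j w, w.length = u.length + 1 → Full S w → H j w = H' j w) :
    insSum q S u H = insSum q S u H' :=
  le_antisymm (insSum_mono hu fun j w hl hw => (h j w hl hw).le)
    (insSum_mono hu fun j w hl hw => (h j w hl hw).ge)

theorem insSum_add (q : Fin n) (S : Finset (Fin n)) (u : List (Fin n))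
    (H H' : ℕ → List (Fin n) → ℝ) :
    insSum q S u (fun j w => H j w + H' j w) = insSum q S u H + insSum q S u H' := by
  induction u generalizing S H H' with
  | nil => simp [insSum]
  | cons a u ih => simp only [insSum, ih]; split_ifs <;> ring

theorem insSum_const_mul (q : Fin n) (S : Finset (Fin n)) (u : List (Fin n)) (c : ℝ)
    (H : ℕ → List (Fin n) → ℝ) :
    insSum q S u (fun j w => c * H j w) = c * insSum q S u H := by
  induction u generalizing S H with
  | nil => simp [insSum]
  | cons a u ih => simp only [insSum, ih]; split_ifs <;> ring

theorem insSum_zero (q : Fin n) (S : Finset (Fin n)) (u : List (Fin n)) :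
    insSum q S u (fun _ _ => 0) = 0 := by
  simpa using insSum_const_mul q S u 0 fun _ _ => 0

theorem insSum_nonneg {q : Fin n} {S : Finset (Fin n)} {u : List (Fin n)}
    {H : ℕ → List (Fin n) → ℝ} (hu : Full S u) (h : ∀ j w, Full S w → 0 ≤ H j w) :
    0 ≤ insSum q S u H :=
  (insSum_zero q S u).symm.trans_le (insSum_mono hu fun j w _ hw => h j w hw)

/-- If `q` occurs in `u`, only `u` matters for the insertions into `u ++ v`. -/
theorem insSum_append {q : Fin n} {S : Finset (Fin n)} {u : List (Fin n)} (hq : q ∈ u)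
    (v : List (Fin n)) (H : ℕ → List (Fin n) → ℝ) :
    insSum q S (u ++ v) H = insSum q S u fun j w => H j (w ++ v) := by
  induction u generalizing S H with
  | nil => simp at hq
  | cons a u ih =>
    simp only [List.cons_append, insSum]
    split_ifs with h
    · rfl
    · rw [ih (by simpa [Ne.symm h] using hq)]

/-- The invariance of the weight `wt x y`: the weights of the words which become `u` by the
deletion of a `q`, multiplied by the probabilities of this deletion, add up to `wt x y S u / n`
if `S = ∅`. The subtracted term stands for the insertions before the letters of `S`. -/
theorem insSum_wt {s c x y : ℕ → ℝ} (hc : ∀ j, c (j + 1) = c j + s j)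
    (hx : ∀ j, 1 ≤ j → j ≤ n → x j * c j = 1 / n) {q : Fin n} {S : Finset (Fin n)}
    {u : List (Fin n)} (hq : q ∉ S) (hu : Full S u) :
    insSum q S u (fun j w => s j * wt x y S w) =
      wt x y S u / n - c S.card * y S.card * wt x y (insert q S) u := by
  induction u generalizing S with
  | nil =>
    have hS : S = univ := hu
    simp [hS] at hq
  | cons a u ih =>
    have hcard := card_lt_of_notMem hq
    have hx1 := hx (S.card + 1) (by omega) hcard
    rw [hc] at hx1
    simp only [insSum]
    by_cases haq : a = q
    · subst haq
      simp only [wt, hq, if_true, if_false, card_insert_of_notMem hq, mem_insert_self]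
      linear_combination (y #S * wt x y (insert a S) u) * hx1
    · rw [if_neg haq]
      have hq' : q ∉ insert a S := by simp [hq, Ne.symm haq]
      have hI := ih hq' hu
      by_cases haS : a ∈ S
      · have hS0 : 1 ≤ S.card := Finset.card_pos.2 ⟨a, haS⟩
        have hx0 := hx S.card hS0 hcard.le
        rw [insert_eq_of_mem haS] at hI
        simp only [wt, haS, hq, if_true, if_false, card_insert_of_notMem hq, mem_insert_of_mem]
        have e : insSum q (insert a S) u (fun j w => s j * (x #S * wt x y S w)) =
            x #S * insSum q S u (fun j w => s j * wt x y S w) := by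
          rw [insert_eq_of_mem haS, ← insSum_const_mul]
          congr 1; ext j w; ring
        rw [e, hI]
        linear_combination (y #S * wt x y (insert q S) u) * (hx1 - hx0)
      · have haS' : a ∉ insert q S := by simp [haS, haq]
        simp only [wt, haS, hq, haS', if_false, card_insert_of_notMem hq]
        have e : insSum q (insert a S) u (fun j w => s j * (y #S * wt x y (insert a S) w)) =
            y #S * insSum q (insert a S) u (fun j w => s j * wt x y (insert a S) w) := by
          rw [← insSum_const_mul]
          congr 1; ext j w; ring
        rw [e, hI, card_insert_of_notMem haS, hc, Finset.insert_comm q a]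
        ring

/-- Summed over all words, insertions do not increase the mass, as each word becomes at most one
word by the deletion of a given letter. -/
theorem fullSum_insSum_le {s : ℕ → ℝ} (hs : ∀ j, 0 ≤ s j) {L : ℕ} {S : Finset (Fin n)}
    {H : List (Fin n) → ℝ} (hH : ∀ w, Full S w → 0 ≤ H w) :
    fullSum L S (fun u => ∑ q ∈ Sᶜ, insSum q S u fun j w => s j * H w) ≤
      (∑ j ∈ Ico S.card n, s j) * fullSum (L + 1) S H := by
  induction L generalizing S H with
  | zero =>
    have hR : 0 ≤ (∑ j ∈ Ico S.card n, s j) * fullSum (0 + 1) S H :=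
      mul_nonneg (Finset.sum_nonneg fun j _ => hs j) (fullSum_nonneg hH)
    refine le_trans (le_of_eq ?_) hR
    simp only [fullSum]
    split_ifs with h
    · simp [h]
    · rfl
  | succ L ih =>
    have e : ∀ a (u : List (Fin n)),
        (∑ q ∈ Sᶜ, insSum q S (a :: u) fun j w => s j * H w) =
        s #S * (∑ q ∈ Sᶜ, H (q :: a :: u)) + ∑ q ∈ (insert a S)ᶜ,
          insSum q (insert a S) u fun j w => s j * H (a :: w) := by
      intro a u
      simp only [insSum, Finset.sum_add_distrib, Finset.mul_sum]
      congr 1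
      symm
      refine Finset.sum_subset_zero_on_sdiff (compl_subset_compl.2 (subset_insert a S))
        (fun q hq => ?_) (fun q hq => ?_)
      · have : a = q := by
          have hq1 := Finset.mem_sdiff.1 hq
          simp only [mem_compl, mem_insert, not_or, not_and, not_not] at hq1
          by_contra h
          exact hq1.1 (hq1.2 (Ne.symm h))
        simp [this]
      · have : a ≠ q := by
          rintro rfl
          simp at hq
        simp [this]
    rw [fullSum]
    simp only [e, fullSum_add, fullSum_const_mul, fullSum_sum (s := Sᶜ), Finset.sum_add_distrib]
    have h1 : ∑ a, s #S * ∑ q ∈ Sᶜ, fullSum L (insert a S) (fun u => H (q :: a :: u)) ≤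
        s #S * ∑ q ∈ Sᶜ, fullSum (L + 1) (insert q S) (fun u => H (q :: u)) := by
      rw [← Finset.mul_sum, Finset.sum_comm]
      refine mul_le_mul_of_nonneg_left (Finset.sum_le_sum fun q _ => ?_) (hs _)
      refine Finset.sum_le_sum fun a _ => ?_
      exact fullSum_mono_set (insert_subset_insert a (subset_insert q S))
        fun u hu => hH (q :: a :: u) hu
    have h2 : ∀ a, fullSum L (insert a S) (fun u => ∑ q ∈ (insert a S)ᶜ,
          insSum q (insert a S) u fun j w => s j * H (a :: w)) ≤
        (∑ j ∈ Ico (insert a S).card n, s j) *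
          fullSum (L + 1) (insert a S) (fun u => H (a :: u)) :=
      fun a => ih fun w hw => hH (a :: w) hw
    refine (add_le_add h1 (Finset.sum_le_sum fun a _ => h2 a)).trans (le_of_eq ?_)
    rw [show fullSum (L + 1 + 1) S H =
      ∑ a, fullSum (L + 1) (insert a S) (fun u => H (a :: u)) from rfl, Finset.mul_sum,
      Finset.mul_sum]
    have h3 : Sᶜ = univ.filter (· ∉ S) := by ext; simp
    rw [h3, Finset.sum_filter]
    rw [← Finset.sum_add_distrib]
    refine Finset.sum_congr rfl fun a _ => ?_
    by_cases ha : a ∈ S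
    · simp [ha]
    · rw [if_pos ha, card_insert_of_notMem ha, ← add_mul,
        ← Finset.sum_eq_sum_Ico_succ_bot (card_lt_of_notMem ha)]

/-! ### Total mass of a weight -/

theorem wt_nonneg {x y : ℕ → ℝ} (hx : ∀ j, 0 ≤ x j) (hy : ∀ j, 0 ≤ y j) (S : Finset (Fin n))
    (u : List (Fin n)) : 0 ≤ wt x y S u := by
  induction u generalizing S with
  | nil => exact zero_le_one
  | cons a u ih =>
    simp only [wt]
    split_ifs
    · exact mul_nonneg (hx _) (ih _)
    · exact mul_nonneg (hy _) (ih _)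

theorem wt_uniformTail {x y : ℕ → ℝ} (hx : x n = 1 / n) (S : Finset (Fin n)) :
    UniformTail S (wt x y S) := by
  intro u a hu
  induction u generalizing S with
  | nil =>
    have hS : S = univ := hu
    subst hS
    simp [wt, hx]
  | cons b u ih =>
    have h := ih (insert b S) hu
    simp only [List.cons_append, wt]
    split_ifs with hb
    · rw [insert_eq_of_mem hb] at h
      rw [h]; ring
    · rw [h]; ring

theorem fullSum_wt_succ (x y : ℕ → ℝ) (L : ℕ) (S : Finset (Fin n)) :
    fullSum (L + 1) S (wt x y S) = S.card * x S.card * fullSum L S (wt x y S) +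
      ∑ a ∈ Sᶜ, y S.card * fullSum L (insert a S) (wt x y (insert a S)) := by
  rw [fullSum, ← Finset.sum_add_sum_compl S]
  congr 1
  · rw [mul_assoc, ← nsmul_eq_mul]
    refine Finset.sum_eq_card_nsmul fun a ha => ?_
    rw [← fullSum_const_mul, insert_eq_of_mem ha]
    exact fullSum_congr fun u _ _ => by simp [wt, ha]
  · refine Finset.sum_congr rfl fun a ha => ?_
    rw [mem_compl] at ha
    rw [← fullSum_const_mul]
    exact fullSum_congr fun u _ _ => by simp [wt, ha]

theorem sum_compl_const (S : Finset (Fin n)) (c : ℝ) :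
    ∑ _a ∈ Sᶜ, c = ((n : ℝ) - S.card) * c := by
  have : S.card ≤ n := by simpa using S.card_le_univ
  simp [card_compl, Nat.cast_sub this]

theorem fullSum_wt_le_one {x y : ℕ → ℝ} (hx : ∀ j, 0 ≤ x j) (hy : ∀ j, 0 ≤ y j)
    (hxy : ∀ j ≤ n, j * x j + (n - j) * y j = 1) (L : ℕ) (S : Finset (Fin n)) :
    fullSum L S (wt x y S) ≤ 1 := by
  induction L generalizing S with
  | zero => simp only [fullSum, wt]; split_ifs <;> simp
  | succ L ih =>
    have hS : S.card ≤ n := by simpa using S.card_le_univ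
    rw [fullSum_wt_succ, ← hxy _ hS, ← sum_compl_const]
    refine add_le_add ?_ (Finset.sum_le_sum fun a _ => ?_)
    · exact mul_le_of_le_one_right (mul_nonneg (Nat.cast_nonneg _) (hx _)) (ih S)
    · exact mul_le_of_le_one_right (hy _) (ih _)

/-- If `wt x y` is the weight of a Markov chain of words in which new letters keep coming, then
almost surely all letters are seen eventually. -/
theorem tendsto_fullSum_wt [NeZero n] {x y : ℕ → ℝ} (hx : ∀ j, 0 ≤ x j) (hy : ∀ j, 0 ≤ y j)
    (hy' : ∀ j < n, 0 < y j) (hxy : ∀ j ≤ n, j * x j + (n - j) * y j = 1)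
    (S : Finset (Fin n)) : Tendsto (fun L => fullSum L S (wt x y S)) atTop (𝓝 1) := by
  have hn : (n : ℝ) ≠ 0 := NeZero.ne _
  have hxn : x n = 1 / n := by
    have := hxy n le_rfl
    rw [eq_div_iff hn]
    linarith
  induction hk : n - S.card generalizing S with
  | zero =>
    have hS : S = univ := by
      refine eq_univ_of_card S (le_antisymm S.card_le_univ ?_)
      simp
      omega
    subst hS
    have : ∀ L, fullSum L univ (wt x y univ) = 1 := fun L =>
      fullSum_univ_of_uniformTail L (wt_uniformTail hxn univ)
    simp [this]
  | succ k ih =>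
    have hS : S.card < n := by omega
    have hmono : Monotone fun L => fullSum L S (wt x y S) := monotone_nat_of_le_succ fun L =>
      fullSum_le_succ (wt_uniformTail hxn S) fun u _ => wt_nonneg hx hy S u
    have hbdd : BddAbove (Set.range fun L => fullSum L S (wt x y S)) :=
      ⟨1, by rintro _ ⟨L, rfl⟩; exact fullSum_wt_le_one hx hy hxy L S⟩
    have hlim := tendsto_atTop_ciSup hmono hbdd
    set l := ⨆ L, fullSum L S (wt x y S)
    have h1 : Tendsto (fun L => fullSum (L + 1) S (wt x y S)) atTop (𝓝 l) :=
      hlim.comp (tendsto_add_atTop_nat 1)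
    have h2 : Tendsto (fun L => fullSum (L + 1) S (wt x y S)) atTop
        (𝓝 (S.card * x S.card * l + ∑ _a ∈ Sᶜ, y S.card * 1)) := by
      simp only [fullSum_wt_succ]
      refine (hlim.const_mul _).add (tendsto_finsetSum _ fun a ha => ?_)
      rw [mem_compl] at ha
      exact (ih (insert a S) (by rw [card_insert_of_notMem ha]; omega)).const_mul _
    -- the limit solves a linear equation whose only solution is `1`
    have h3 := tendsto_nhds_unique h1 h2
    rw [sum_compl_const, mul_one] at h3
    have h4 : 0 < ((n : ℝ) - S.card) * y S.card :=
      mul_pos (sub_pos.2 (by exact_mod_cast hS)) (hy' _ hS)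
    have h5 := hxy _ hS.le
    have h6 : ((n : ℝ) - S.card) * y S.card * l = ((n : ℝ) - S.card) * y S.card * 1 := by
      linear_combination h3 + l * h5
    rwa [mul_left_cancel₀ h4.ne' h6] at hlim

/-- The uniform weight of words has a bounded density with respect to `wt x y`. -/
theorem one_div_pow_le_wt [NeZero n] {x y : ℕ → ℝ} (hx : ∀ j, 1 ≤ j → j ≤ n → 1 / n ≤ x j)
    (hy' : ∀ j < n, 0 < y j) {S : Finset (Fin n)} {u : List (Fin n)} (hu : Full S u) :
    (1 / n : ℝ) ^ u.length ≤ (∏ j ∈ Ico S.card n, (y j)⁻¹) * wt x y S u := by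
  have hn : (1 : ℝ) ≤ n := by exact_mod_cast NeZero.one_le
  induction u generalizing S with
  | nil =>
    have hS : S = univ := hu
    simp [hS, wt]
  | cons a u ih =>
    have h := ih (S := insert a S) hu
    have h0 : (0 : ℝ) ≤ (1 / n : ℝ) ^ u.length := by positivity
    simp only [wt, List.length_cons, pow_succ']
    split_ifs with ha
    · rw [insert_eq_of_mem ha] at h
      have hS : S.card ≤ n := by simpa using S.card_le_univ
      have h1 := hx S.card (Finset.card_pos.2 ⟨a, ha⟩) hS
      calc _ ≤ x S.card * ((∏ j ∈ Ico S.card n, (y j)⁻¹) * wt x y S u) :=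
            mul_le_mul h1 h h0 (le_trans (by positivity) h1)
        _ = _ := by ring
    · have hS := card_lt_of_notMem ha
      rw [card_insert_of_notMem ha] at h
      rw [Finset.prod_eq_prod_Ico_succ_bot hS]
      have hy1 := hy' _ hS
      calc _ ≤ 1 * (1 / n : ℝ) ^ u.length := by
            refine mul_le_mul_of_nonneg_right ?_ h0
            rw [div_le_one (by linarith)]
            exact hn
        _ ≤ (∏ j ∈ Ico (S.card + 1) n, (y j)⁻¹) * wt x y (insert a S) u := by rwa [one_mul]
        _ = _ := by field_simp

theorem tendsto_fullSum {ι : Type*} {l : Filter ι} {L : ℕ} {S : Finset (Fin n)}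
    {F : ι → List (Fin n) → ℝ} {G : List (Fin n) → ℝ}
    (h : ∀ u, u.length = L → Full S u → Tendsto (fun i => F i u) l (𝓝 (G u))) :
    Tendsto (fun i => fullSum L S (F i)) l (𝓝 (fullSum L S G)) := by
  induction L generalizing S F G with
  | zero =>
    simp only [fullSum]
    split_ifs with hS
    · exact h [] rfl hS
    · exact tendsto_const_nhds
  | succ L ih =>
    exact tendsto_finsetSum _ fun a _ => ih fun u hu hf => h (a :: u) (by simp [hu]) hf

/-! ### The masks of new letters -/

/-- Records which letters of a word are new, if the letters in `S` have been seen before. -/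
def newMask : Finset (Fin n) → List (Fin n) → List Bool
  | _, [] => []
  | S, a :: u => decide (a ∉ S) :: newMask (insert a S) u

/-- The weight of the set of all words with a given mask that are read after `j` distinct letters
and contain all remaining letters. -/
def maskWeight (n : ℕ) (x y : ℕ → ℝ) : ℕ → List Bool → ℝ
  | j, [] => if j = n then 1 else 0
  | j, true :: b => (n - j) * y j * maskWeight n x y (j + 1) b
  | j, false :: b => j * x j * maskWeight n x y j b

/-- The mask of a word that ends with the last new letter, where `ds` lists the numbers of old
letters between successive new letters. -/
def gapMask : List ℕ → List Bool
  | [] => [true]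
  | e :: ds => true :: (List.replicate e false ++ gapMask ds)

theorem fullSum_mask (x y : ℕ → ℝ) (b : List Bool) (S : Finset (Fin n)) :
    fullSum b.length S (fun u => if newMask S u = b then wt x y S u else 0) =
      maskWeight n x y S.card b := by
  induction b generalizing S with
  | nil =>
    have : S = univ ↔ S.card = n := by rw [← Finset.card_eq_iff_eq_univ]; simp
    simp [fullSum, maskWeight, newMask, wt, this]
  | cons t b ih =>
    rw [List.length_cons, fullSum, ← Finset.sum_add_sum_compl S]
    have h1 : ∀ a ∈ S, fullSum b.length (insert a S)
        (fun u => if newMask S (a :: u) = t :: b then wt x y S (a :: u) else 0) =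
        if t then 0 else x S.card * maskWeight n x y S.card b := by
      intro a ha
      cases t
      · have := ih S
        simp only [Bool.false_eq_true, if_false]
        rw [← this, ← fullSum_const_mul, insert_eq_of_mem ha]
        exact fullSum_congr fun u _ _ => by simp [wt, newMask, ha]
      · simp [newMask, ha, fullSum_zero]
    have h2 : ∀ a ∈ Sᶜ, fullSum b.length (insert a S)
        (fun u => if newMask S (a :: u) = t :: b then wt x y S (a :: u) else 0) =
        if t then y S.card * maskWeight n x y (S.card + 1) b else 0 := by
      intro a ha
      rw [mem_compl] at ha
      cases t
      · simp [newMask, ha, fullSum_zero]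
      · have := ih (insert a S)
        rw [card_insert_of_notMem ha] at this
        simp only [if_true]
        rw [← this, ← fullSum_const_mul]
        exact fullSum_congr fun u _ _ => by simp [wt, newMask, ha]
    rw [Finset.sum_congr rfl h1, Finset.sum_congr rfl h2, sum_compl_const]
    cases t <;> simp [maskWeight, mul_assoc]

theorem maskWeight_replicate (x y : ℕ → ℝ) (j e : ℕ) (b : List Bool) :
    maskWeight n x y j (List.replicate e false ++ b) = (j * x j) ^ e * maskWeight n x y j b := by
  induction e with
  | zero => simp
  | succ e ih => simp only [List.replicate_succ, List.cons_append, maskWeight, ih]; ring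

theorem maskWeight_gapMask (x y : ℕ → ℝ) {j m : ℕ} (h : j + m + 1 = n) (d : Fin m → ℕ) :
    maskWeight n x y j (gapMask (List.ofFn d)) = (n - j) * y j *
      ∏ i : Fin m, (((j + 1 + i : ℕ) : ℝ) * x (j + 1 + i)) ^ d i *
        ((n - (j + 1 + i : ℕ)) * y (j + 1 + i)) := by
  induction m generalizing j with
  | zero =>
    have : j + 1 = n := h
    simp [gapMask, maskWeight, this]
  | succ m ih =>
    rw [List.ofFn_succ, gapMask, maskWeight, maskWeight_replicate,
      ih (j := j + 1) (by omega), Fin.prod_univ_succ]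
    have e : ∀ i : Fin m, j + 1 + 1 + (i : ℕ) = j + 1 + (i.succ : ℕ) := fun i => by
      simp; omega
    simp only [e, Fin.val_zero, add_zero]
    ring

/-! ### The stationary weight of a `σ`-MultiQueue -/

/-- The probability of the index number `j` under `σ`, where the indices are counted from `0`. -/
noncomputable def prob (σ : PMF (Fin n)) (j : ℕ) : ℝ := cumul σ (j + 1) - cumul σ j

/-- The stationary probability of each old letter after `j` distinct letters; the value for `j = 0`
is irrelevant, as there is no old letter at the beginning. -/
noncomputable def oldWeight (σ : PMF (Fin n)) (j : ℕ) : ℝ := 1 / (n * cumul σ j)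

/-- The stationary probability of each new letter after `j` distinct letters; only the values for
`j < n` are relevant. -/
noncomputable def newWeight (σ : PMF (Fin n)) (j : ℕ) : ℝ := (1 - j * oldWeight σ j) / (n - j)

/-- The probability that the word of queue names of the remaining elements in ascending order
starts with `u`, in the stationary state of the process. -/
noncomputable def statWord (σ : PMF (Fin n)) (u : List (Fin n)) : ℝ :=
  wt (oldWeight σ) (newWeight σ) ∅ u

theorem cumul_zero (σ : PMF (Fin n)) : cumul σ 0 = 0 := by simp [cumul]

theorem cumul_succ (σ : PMF (Fin n)) (j : ℕ) : cumul σ (j + 1) = cumul σ j + prob σ j := by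
  simp [prob]

theorem prob_val (σ : PMF (Fin n)) (i : Fin n) : prob σ i = (σ i).toReal := by
  have : univ.filter (fun k : Fin n => k.val < i.val + 1) =
      insert i (univ.filter fun k : Fin n => k.val < i.val) := by
    ext k
    simp only [mem_filter, mem_univ, true_and, mem_insert, Fin.ext_iff]
    omega
  rw [prob, cumul, this, Finset.sum_insert (by simp)]
  simp [cumul]

theorem cumul_mono (σ : PMF (Fin n)) : Monotone (cumul σ) := fun i j hij => by
  refine Finset.sum_le_sum_of_subset_of_nonneg (fun k hk => ?_) fun _ _ _ => ENNReal.toReal_nonneg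
  simp only [mem_filter, mem_univ, true_and] at hk ⊢
  omega

theorem prob_nonneg (σ : PMF (Fin n)) (j : ℕ) : 0 ≤ prob σ j :=
  sub_nonneg.2 (cumul_mono σ (Nat.le_succ j))

theorem cumul_self (σ : PMF (Fin n)) : cumul σ n = 1 := by
  have h : ∑ i, σ i = 1 := (tsum_fintype _).symm.trans σ.tsum_coe
  have : ∀ k : Fin n, k.val < n := fun k => k.isLt
  simp only [cumul, this, Finset.filter_true]
  rw [← ENNReal.toReal_sum fun i _ => σ.apply_ne_top i, h, ENNReal.toReal_one]

theorem cumul_of_le (σ : PMF (Fin n)) {j : ℕ} (hj : n ≤ j) : cumul σ j = 1 := by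
  rw [← cumul_self σ]
  refine Finset.sum_congr ?_ fun _ _ => rfl
  ext k
  have := k.isLt
  simp only [mem_filter, mem_univ, true_and]
  omega

theorem prob_of_le (σ : PMF (Fin n)) {j : ℕ} (hj : n ≤ j) : prob σ j = 0 := by
  rw [prob, cumul_of_le σ hj, cumul_of_le σ (by omega), sub_self]

theorem sum_prob (σ : PMF (Fin n)) : ∑ j ∈ Ico 0 n, prob σ j = 1 := by
  rw [← Finset.range_eq_Ico]
  simp only [prob]
  rw [Finset.sum_range_sub, cumul_self, cumul_zero, sub_zero]

section Star

variable {σ : PMF (Fin n)}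

theorem Star.div_le_cumul [NeZero n] (hσ : Star σ) {j : ℕ} (h1 : 1 ≤ j) (hj : j ≤ n) :
    (j : ℝ) / n ≤ cumul σ j := by
  rcases hj.lt_or_eq with h | rfl
  · exact (hσ j h1 h).le
  · rw [cumul_self, div_self (NeZero.ne _)]

theorem Star.cumul_pos [NeZero n] (hσ : Star σ) {j : ℕ} (h1 : 1 ≤ j) (hj : j ≤ n) :
    0 < cumul σ j := by
  have : 0 < n := by omega
  exact lt_of_lt_of_le (by positivity) (hσ.div_le_cumul h1 hj)

theorem Star.prob_zero_pos [NeZero n] (hσ : Star σ) : 0 < prob σ 0 := by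
  simpa [prob, cumul_zero] using hσ.cumul_pos le_rfl (NeZero.one_le (n := n))

theorem oldWeight_nonneg (σ : PMF (Fin n)) (j : ℕ) : 0 ≤ oldWeight σ j := by
  have : 0 ≤ cumul σ j := Finset.sum_nonneg fun _ _ => ENNReal.toReal_nonneg
  unfold oldWeight
  positivity

theorem Star.oldWeight_mul [NeZero n] (hσ : Star σ) (j : ℕ) (h1 : 1 ≤ j) (hj : j ≤ n) :
    oldWeight σ j * cumul σ j = 1 / n := by
  have := hσ.cumul_pos h1 hj
  have hn : (n : ℝ) ≠ 0 := NeZero.ne _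
  unfold oldWeight
  field_simp

theorem oldWeight_self : oldWeight σ n = 1 / n := by simp [oldWeight, cumul_self]

theorem Star.one_div_le_oldWeight [NeZero n] (hσ : Star σ) (j : ℕ) (h1 : 1 ≤ j) (hj : j ≤ n) :
    1 / (n : ℝ) ≤ oldWeight σ j := by
  have h2 : cumul σ j ≤ 1 := cumul_self σ ▸ cumul_mono σ hj
  rw [← hσ.oldWeight_mul j h1 hj]
  exact mul_le_of_le_one_right (oldWeight_nonneg σ j) h2

theorem Star.mul_oldWeight_lt [NeZero n] (hσ : Star σ) {j : ℕ} (hj : j < n) :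
    j * oldWeight σ j < 1 := by
  rcases Nat.eq_zero_or_pos j with rfl | h1
  · simp
  · have h := hσ j h1 hj
    have hn : (0 : ℝ) < n := by exact_mod_cast (by omega : 0 < n)
    have hc := hσ.cumul_pos h1 hj.le
    rw [oldWeight, mul_one_div, div_lt_one (by positivity)]
    rwa [div_lt_iff₀ hn, mul_comm] at h

theorem Star.newWeight_pos [NeZero n] (hσ : Star σ) (j : ℕ) (hj : j < n) : 0 < newWeight σ j :=
  div_pos (sub_pos.2 (hσ.mul_oldWeight_lt hj)) (sub_pos.2 (by exact_mod_cast hj))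

theorem sub_mul_newWeight {j : ℕ} (hj : j < n) :
    ((n : ℝ) - j) * newWeight σ j = 1 - j * oldWeight σ j := by
  have : (0 : ℝ) < n - j := sub_pos.2 (by exact_mod_cast hj)
  rw [newWeight, mul_div_cancel₀ _ this.ne']

theorem old_add_new [NeZero n] (σ : PMF (Fin n)) (j : ℕ) (hj : j ≤ n) :
    j * oldWeight σ j + (n - j) * newWeight σ j = 1 := by
  rcases hj.lt_or_eq with h | rfl
  · rw [sub_mul_newWeight h]; ring
  · have hn : (j : ℝ) ≠ 0 := NeZero.ne _
    rw [oldWeight_self]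
    field_simp
    ring

theorem wt_pos {x y : ℕ → ℝ} (hx : ∀ j, 1 ≤ j → j ≤ n → 0 < x j) (hy : ∀ j < n, 0 < y j)
    (S : Finset (Fin n)) (u : List (Fin n)) : 0 < wt x y S u := by
  induction u generalizing S with
  | nil => exact zero_lt_one
  | cons a u ih =>
    simp only [wt]
    split_ifs with ha
    · exact mul_pos (hx _ (Finset.card_pos.2 ⟨a, ha⟩) (by simpa using S.card_le_univ)) (ih _)
    · exact mul_pos (hy _ (card_lt_of_notMem ha)) (ih _)

theorem Star.statWord_pos [NeZero n] (hσ : Star σ) (u : List (Fin n)) : 0 < statWord σ u :=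
  wt_pos (fun j h1 hj => lt_of_lt_of_le (by
    have : 0 < n := by omega
    positivity) (hσ.one_div_le_oldWeight j h1 hj)) hσ.newWeight_pos ∅ u

theorem statWord_uniformTail : UniformTail ∅ (statWord σ) := wt_uniformTail oldWeight_self ∅

theorem Star.newWeight_nonneg [NeZero n] (hσ : Star σ) (j : ℕ) : 0 ≤ newWeight σ j := by
  rcases lt_trichotomy j n with h | rfl | h
  · exact (hσ.newWeight_pos j h).le
  · simp [newWeight]
  · have hn : (0 : ℝ) < n := by exact_mod_cast NeZero.pos n
    have hj : (n : ℝ) < j := by exact_mod_cast h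
    refine div_nonneg_of_nonpos ?_ (by linarith)
    rw [oldWeight, cumul_of_le σ h.le, mul_one, mul_one_div, sub_nonpos, one_le_div hn]
    exact hj.le

theorem Star.tendsto_fullSum_statWord [NeZero n] (hσ : Star σ) :
    Tendsto (fun L => fullSum L ∅ (statWord σ)) atTop (𝓝 1) :=
  tendsto_fullSum_wt (oldWeight_nonneg σ) hσ.newWeight_nonneg hσ.newWeight_pos (old_add_new σ) ∅

theorem Star.fullSum_statWord_le [NeZero n] (hσ : Star σ) (L : ℕ) : fullSum L ∅ (statWord σ) ≤ 1 :=
  fullSum_wt_le_one (oldWeight_nonneg σ) hσ.newWeight_nonneg (old_add_new σ) L ∅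

/-! ### One step of the process -/

/-- The effect of one deletion on the probabilities that the word of queue names starts with a
given full word. -/
noncomputable def stepOp (σ : PMF (Fin n)) (H : List (Fin n) → ℝ) (u : List (Fin n)) : ℝ :=
  ∑ q, insSum q ∅ u fun j w => prob σ j * H w

/-- The probability that the word of queue names starts with the full word `u` after `s`
deletions. -/
noncomputable def wordProb (σ : PMF (Fin n)) : ℕ → List (Fin n) → ℝ
  | 0, u => (1 / n : ℝ) ^ u.length
  | s + 1, u => stepOp σ (wordProb σ s) u

theorem stepOp_mono {H H' : List (Fin n) → ℝ} {u : List (Fin n)} (hu : Full ∅ u)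
    (h : ∀ w, Full ∅ w → H w ≤ H' w) : stepOp σ H u ≤ stepOp σ H' u :=
  Finset.sum_le_sum fun _ _ => insSum_mono hu fun j w _ hw =>
    mul_le_mul_of_nonneg_left (h w hw) (prob_nonneg σ j)

theorem stepOp_congr {H H' : List (Fin n) → ℝ} {u : List (Fin n)} (hu : Full ∅ u)
    (h : ∀ w, Full ∅ w → H w = H' w) : stepOp σ H u = stepOp σ H' u :=
  le_antisymm (stepOp_mono hu fun w hw => (h w hw).le) (stepOp_mono hu fun w hw => (h w hw).ge)

theorem stepOp_add (H H' : List (Fin n) → ℝ) (u : List (Fin n)) :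
    stepOp σ (fun w => H w + H' w) u = stepOp σ H u + stepOp σ H' u := by
  simp only [stepOp, mul_add, insSum_add, Finset.sum_add_distrib]

theorem stepOp_const_mul (c : ℝ) (H : List (Fin n) → ℝ) (u : List (Fin n)) :
    stepOp σ (fun w => c * H w) u = c * stepOp σ H u := by
  simp only [stepOp, mul_left_comm _ c, insSum_const_mul, Finset.mul_sum]

theorem stepOp_nonneg {H : List (Fin n) → ℝ} {u : List (Fin n)} (hu : Full ∅ u)
    (h : ∀ w, Full ∅ w → 0 ≤ H w) : 0 ≤ stepOp σ H u :=
  Finset.sum_nonneg fun _ _ => insSum_nonneg hu fun j w hw => mul_nonneg (prob_nonneg σ j) (h w hw)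

theorem Star.stepOp_statWord [NeZero n] (hσ : Star σ) {u : List (Fin n)} (hu : Full ∅ u) :
    stepOp σ (statWord σ) u = statWord σ u := by
  have hn : (n : ℝ) ≠ 0 := NeZero.ne _
  have : ∀ q : Fin n, insSum q ∅ u (fun j w => prob σ j * statWord σ w) = statWord σ u / n := by
    intro q
    have := insSum_wt (y := newWeight σ) (cumul_succ σ) hσ.oldWeight_mul
      (Finset.notMem_empty q) hu
    simpa [cumul_zero, statWord] using this
  simp only [stepOp, this]
  simp [mul_div_cancel₀ _ hn]

theorem UniformTail.stepOp {H : List (Fin n) → ℝ} (hH : UniformTail ∅ H) :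
    UniformTail ∅ (stepOp σ H) := by
  intro u a hu
  rw [div_eq_inv_mul, SigmaMultiQueue.stepOp, SigmaMultiQueue.stepOp, Finset.mul_sum]
  refine Finset.sum_congr rfl fun q _ => ?_
  have hq : q ∈ u := by simpa using full_iff.1 hu q
  rw [insSum_append hq, ← insSum_const_mul]
  refine insSum_congr hu fun j w _ hw => ?_
  rw [hH w a hw]
  ring

theorem wordProb_uniformTail (s : ℕ) : UniformTail ∅ (wordProb σ s) := by
  induction s with
  | zero =>
    intro u a _
    simp [wordProb, pow_succ]
    rfl
  | succ s ih => exact ih.stepOp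

theorem wordProb_nonneg (s : ℕ) {u : List (Fin n)} (hu : Full ∅ u) : 0 ≤ wordProb σ s u := by
  induction s generalizing u with
  | zero => simp only [wordProb]; positivity
  | succ s ih => exact stepOp_nonneg hu fun w hw => ih hw

theorem fullSum_stepOp_le {H : List (Fin n) → ℝ} (hH : ∀ w, Full ∅ w → 0 ≤ H w) (L : ℕ) :
    fullSum L ∅ (stepOp σ H) ≤ fullSum (L + 1) ∅ H := by
  have := fullSum_insSum_le (prob_nonneg σ) (L := L) hH
  rw [card_empty, sum_prob, one_mul, compl_empty] at this
  exact this

/-- The operator `stepOp` is bounded below by the contribution of a deletion of the least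
element. -/
theorem prob_zero_mul_le_stepOp {H : List (Fin n) → ℝ} {u : List (Fin n)} (hu : Full ∅ u)
    (h : ∀ w, Full ∅ w → 0 ≤ H w) (q : Fin n) : prob σ 0 * H (q :: u) ≤ stepOp σ H u := by
  have h1 : ∀ j w, Full ∅ w → 0 ≤ prob σ j * H w := fun j w hw =>
    mul_nonneg (prob_nonneg σ j) (h w hw)
  refine le_trans ?_ (Finset.single_le_sum (f := fun q => insSum q ∅ u fun j w => prob σ j * H w)
    (fun p _ => insSum_nonneg hu h1) (mem_univ q))
  cases u with
  | nil =>
    have := full_iff.1 hu q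
    simp at this
  | cons a u =>
    simp only [insSum, card_empty, le_add_iff_nonneg_right]
    split_ifs
    · exact le_rfl
    · exact insSum_nonneg (S := insert a ∅) hu fun j w hw => h1 j (a :: w) hw

/-! ### Convergence of the word probabilities -/

/-- An upper bound for the density of the initial state with respect to the stationary state. -/
noncomputable def densityBound (σ : PMF (Fin n)) : ℝ := ∏ j ∈ Ico 0 n, (newWeight σ j)⁻¹

theorem Star.wordProb_le [NeZero n] (hσ : Star σ) (s : ℕ) {u : List (Fin n)} (hu : Full ∅ u) :
    wordProb σ s u ≤ densityBound σ * statWord σ u := by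
  induction s generalizing u with
  | zero => exact one_div_pow_le_wt hσ.one_div_le_oldWeight hσ.newWeight_pos hu
  | succ s ih =>
    rw [← hσ.stepOp_statWord hu, ← stepOp_const_mul]
    exact stepOp_mono hu fun w hw => ih hw

/-- After any number of deletions, almost surely all queues are nonempty. The lower bound on the
mass comes from `stepOp` not increasing the mass of `densityBound σ * statWord σ - wordProb σ s`. -/
theorem Star.tendsto_fullSum_wordProb [NeZero n] (hσ : Star σ) (s : ℕ) :
    Tendsto (fun L => fullSum L ∅ (wordProb σ s)) atTop (𝓝 1) := by
  induction s with
  | zero =>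
    have hn : (0 : ℝ) < n := by exact_mod_cast NeZero.pos n
    have h := tendsto_fullSum_wt (n := n) (x := fun _ => 1 / n) (y := fun _ => 1 / n)
      (fun _ => by positivity) (fun _ => by positivity) (fun _ _ => by positivity)
      (fun j _ => by field_simp; ring) ∅
    convert! h using 2 with L
    have : ∀ (u : List (Fin n)) (S : Finset (Fin n)),
        wt (fun _ => 1 / (n : ℝ)) (fun _ => 1 / n) S u = (1 / n) ^ u.length := by
      intro u
      induction u with
      | nil => simp [wt]
      | cons a u ih =>
        intro S
        simp only [wt, ih, ite_self, List.length_cons, pow_succ']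
    exact fullSum_congr fun u _ _ => (this u ∅).symm
  | succ s ih =>
    have ih' := ih.comp (tendsto_add_atTop_nat 1)
    have hW := hσ.tendsto_fullSum_statWord
    have hW' := hW.comp (tendsto_add_atTop_nat 1)
    refine tendsto_of_tendsto_of_tendsto_of_le_of_le
      (g := fun L => densityBound σ * fullSum L ∅ (statWord σ) -
        (densityBound σ * fullSum (L + 1) ∅ (statWord σ) - fullSum (L + 1) ∅ (wordProb σ s)))
      (h := fun L => fullSum (L + 1) ∅ (wordProb σ s)) ?_ ih' (fun L => ?_) (fun L => ?_)
    · simpa using (hW.const_mul (densityBound σ)).sub ((hW'.const_mul (densityBound σ)).sub ih')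
    · have h := fullSum_stepOp_le (σ := σ)
        (H := fun w => densityBound σ * statWord σ w + (-1) * wordProb σ s w)
        (fun w hw => by linarith [hσ.wordProb_le s hw]) L
      have e : fullSum L ∅ (stepOp σ fun w => densityBound σ * statWord σ w +
          (-1) * wordProb σ s w) =
          fullSum L ∅ (fun u => densityBound σ * statWord σ u + (-1) * wordProb σ (s + 1) u) :=
        fullSum_congr fun u _ hu => by
          rw [stepOp_add, stepOp_const_mul, stepOp_const_mul, hσ.stepOp_statWord hu]
          rfl
      rw [e] at h
      simp only [fullSum_add, fullSum_const_mul] at h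
      simp only
      linarith
    · exact fullSum_stepOp_le (fun w hw => wordProb_nonneg s hw) L

/-- The density of the word probabilities after `s` deletions with respect to the stationary
ones. -/
noncomputable def density (σ : PMF (Fin n)) (s : ℕ) (u : List (Fin n)) : ℝ :=
  wordProb σ s u / statWord σ u

theorem Star.density_append [NeZero n] (hσ : Star σ) (s : ℕ) {u : List (Fin n)} (hu : Full ∅ u)
    (v : List (Fin n)) : density σ s (u ++ v) = density σ s u := by
  have hn : (n : ℝ) ≠ 0 := NeZero.ne _
  have := (hσ.statWord_pos u).ne'
  rw [density, density, (wordProb_uniformTail s).append hu, statWord_uniformTail.append hu]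
  field_simp

theorem Star.density_mul [NeZero n] (hσ : Star σ) (s : ℕ) (u : List (Fin n)) :
    density σ s u * statWord σ u = wordProb σ s u :=
  div_mul_cancel₀ _ (hσ.statWord_pos u).ne'

theorem Star.density_nonneg [NeZero n] (hσ : Star σ) (s : ℕ) {u : List (Fin n)} (hu : Full ∅ u) :
    0 ≤ density σ s u :=
  div_nonneg (wordProb_nonneg s hu) (hσ.statWord_pos u).le

theorem Star.density_le [NeZero n] (hσ : Star σ) (s : ℕ) {u : List (Fin n)} (hu : Full ∅ u) :
    density σ s u ≤ densityBound σ :=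
  (div_le_iff₀ (hσ.statWord_pos u)).2 (hσ.wordProb_le s hu)

/-- The integral of `density σ s ^ 2` in the stationary state over the infinite words that start
with `u`. -/
noncomputable def energyDensity (σ : PMF (Fin n)) (s : ℕ) (u : List (Fin n)) : ℝ :=
  statWord σ u * density σ s u ^ 2

theorem Star.energyDensity_uniformTail [NeZero n] (hσ : Star σ) (s : ℕ) :
    UniformTail ∅ (energyDensity σ s) := by
  intro u a hu
  rw [energyDensity, energyDensity, hσ.density_append s hu, statWord_uniformTail u a hu]
  ring

theorem Star.energyDensity_nonneg [NeZero n] (hσ : Star σ) (s : ℕ) (u : List (Fin n)) :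
    0 ≤ energyDensity σ s u :=
  mul_nonneg (hσ.statWord_pos u).le (sq_nonneg _)

/-- The squared `L²`-norm, in the stationary state, of the density after `s` deletions. -/
noncomputable def energy (σ : PMF (Fin n)) (s : ℕ) : ℝ :=
  ⨆ L, fullSum L ∅ (energyDensity σ s)

theorem Star.tendsto_energy [NeZero n] (hσ : Star σ) (s : ℕ) :
    Tendsto (fun L => fullSum L ∅ (energyDensity σ s)) atTop (𝓝 (energy σ s)) := by
  refine tendsto_atTop_ciSup (monotone_nat_of_le_succ fun L =>
    fullSum_le_succ (hσ.energyDensity_uniformTail s) fun u _ => hσ.energyDensity_nonneg s u)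
    ⟨densityBound σ ^ 2, ?_⟩
  rintro _ ⟨L, rfl⟩
  calc fullSum L ∅ (energyDensity σ s)
      ≤ fullSum L ∅ (fun u => densityBound σ ^ 2 * statWord σ u) := fullSum_mono fun u _ hu => by
        rw [energyDensity, mul_comm]
        exact mul_le_mul_of_nonneg_right
          (pow_le_pow_left₀ (hσ.density_nonneg s hu) (hσ.density_le s hu) 2)
          (hσ.statWord_pos u).le
    _ ≤ densityBound σ ^ 2 := by
        rw [fullSum_const_mul]
        exact mul_le_of_le_one_right (sq_nonneg _) (hσ.fullSum_statWord_le L)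

/-- The loss in Jensen's inequality for one step of the process. -/
theorem Star.sq_sub_le [NeZero n] (hσ : Star σ) (s : ℕ) {u : List (Fin n)} (hu : Full ∅ u)
    (q : Fin n) :
    prob σ 0 * (statWord σ (q :: u) * (density σ s (q :: u) - density σ (s + 1) u) ^ 2) ≤
      stepOp σ (energyDensity σ s) u - energyDensity σ (s + 1) u := by
  set f := density σ (s + 1) u
  have h1 := prob_zero_mul_le_stepOp (σ := σ)
    (H := fun w => statWord σ w * (density σ s w - f) ^ 2) hu
    (fun w _ => mul_nonneg (hσ.statWord_pos w).le (sq_nonneg _)) q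
  refine h1.trans (le_of_eq ?_)
  have e : stepOp σ (fun w => statWord σ w * (density σ s w - f) ^ 2) u =
      stepOp σ (fun w => (energyDensity σ s w + (-2 * f) * wordProb σ s w) +
        f ^ 2 * statWord σ w) u :=
    stepOp_congr hu fun w _ => by
      rw [energyDensity, ← hσ.density_mul]
      ring
  rw [e, stepOp_add, stepOp_add, stepOp_const_mul, stepOp_const_mul, hσ.stepOp_statWord hu]
  have h2 : stepOp σ (wordProb σ s) u = f * statWord σ u := (hσ.density_mul (s + 1) u).symm
  rw [h2, energyDensity]
  ring

theorem Star.sq_sub_le_energy [NeZero n] (hσ : Star σ) (s : ℕ) {u : List (Fin n)} (hu : Full ∅ u)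
    (q : Fin n) :
    prob σ 0 * (statWord σ (q :: u) * (density σ s (q :: u) - density σ (s + 1) u) ^ 2) ≤
      energy σ s - energy σ (s + 1) := by
  set D : List (Fin n) → ℝ := fun u =>
    prob σ 0 * (statWord σ (q :: u) * (density σ s (q :: u) - density σ (s + 1) u) ^ 2)
  have hcons : ∀ {v : List (Fin n)}, Full ∅ v → Full ∅ (q :: v) := fun {v} hv =>
    hv.mono subset_rfl (List.subset_cons_self q v)
  have hD : UniformTail ∅ D := by
    intro v a hv
    have h1 := statWord_uniformTail (σ := σ) (q :: v) a (hcons hv)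
    have h2 := hσ.density_append s (hcons hv) [a]
    have h3 := hσ.density_append (s + 1) hv [a]
    simp only [D]
    rw [List.cons_append] at h1 h2
    rw [h1, h2, h3]
    ring
  have hD' : UniformTail univ fun v => D (u ++ v) := by
    intro v a _
    simp only
    rw [← List.append_assoc]
    exact hD _ a (hu.mono subset_rfl (List.subset_append_left u v))
  have hD0 : ∀ v, 0 ≤ D v := fun v =>
    mul_nonneg (prob_nonneg σ 0) (mul_nonneg (hσ.statWord_pos _).le (sq_nonneg _))
  have hbound : ∀ K, D u ≤ fullSum (K + u.length + 1) ∅ (energyDensity σ s) -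
      fullSum (K + u.length) ∅ (energyDensity σ (s + 1)) := by
    intro K
    have h1 := fullSum_univ_of_uniformTail K hD'
    rw [List.append_nil] at h1
    rw [← h1]
    refine (fullSum_append_le hu fun v _ => hD0 v).trans ?_
    rw [add_comm u.length]
    refine (fullSum_mono fun v _ hv => hσ.sq_sub_le s hv q).trans ?_
    rw [fullSum_sub]
    exact sub_le_sub_right (fullSum_stepOp_le (fun w _ => hσ.energyDensity_nonneg s w) _) _
  refine ge_of_tendsto' (((hσ.tendsto_energy s).comp (tendsto_add_atTop_nat (u.length + 1))).sub
    ((hσ.tendsto_energy (s + 1)).comp (tendsto_add_atTop_nat u.length))) fun K => hbound K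

/-- The loss of energy in one step tends to zero, and it bounds the difference of the densities. -/
theorem Star.tendsto_density_cons_sub [NeZero n] (hσ : Star σ) {u : List (Fin n)} (hu : Full ∅ u)
    (q : Fin n) :
    Tendsto (fun s => density σ s (q :: u) - density σ (s + 1) u) atTop (𝓝 0) := by
  have h0 : ∀ s, 0 ≤ energy σ s := fun s =>
    Real.iSup_nonneg fun L => fullSum_nonneg fun u _ => hσ.energyDensity_nonneg s u
  have hc : 0 < prob σ 0 * statWord σ (q :: u) := mul_pos hσ.prob_zero_pos (hσ.statWord_pos _)
  have hanti : Antitone (energy σ) := antitone_nat_of_succ_le fun s => by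
    have h1 := hσ.sq_sub_le_energy s hu q
    have h2 := mul_nonneg hc.le (sq_nonneg (density σ s (q :: u) - density σ (s + 1) u))
    rw [mul_assoc] at h2
    linarith
  have hlim := tendsto_atTop_ciInf hanti ⟨0, by rintro _ ⟨s, rfl⟩; exact h0 s⟩
  have hdiff := hlim.sub (hlim.comp (tendsto_add_atTop_nat 1))
  rw [sub_self] at hdiff
  have hsq : Tendsto (fun s => (density σ s (q :: u) - density σ (s + 1) u) ^ 2) atTop (𝓝 0) := by
    have h1 := hdiff.const_mul (prob σ 0 * statWord σ (q :: u))⁻¹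
    rw [mul_zero] at h1
    refine squeeze_zero (fun s => sq_nonneg _) (fun s => ?_) h1
    rw [← div_eq_inv_mul, le_div_iff₀ hc]
    have := hσ.sq_sub_le_energy s hu q
    simp only [Function.comp_apply]
    linarith
  have := hsq.sqrt
  simp only [Real.sqrt_sq_eq_abs, Real.sqrt_zero] at this
  exact (tendsto_zero_iff_abs_tendsto_zero _).2 this

theorem Star.tendsto_density_append_sub [NeZero n] (hσ : Star σ) {u : List (Fin n)} (hu : Full ∅ u)
    (v : List (Fin n)) :
    Tendsto (fun s => density σ s (v ++ u) - density σ (s + v.length) u) atTop (𝓝 0) := by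
  induction v with
  | nil => simp
  | cons q v ih =>
    have h1 := hσ.tendsto_density_cons_sub
      (hu.mono subset_rfl (List.subset_append_right v u)) q
    have h2 := h1.add (ih.comp (tendsto_add_atTop_nat 1))
    rw [add_zero] at h2
    refine h2.congr fun s => ?_
    simp only [Function.comp_apply, List.length_cons, List.cons_append]
    rw [show s + 1 + v.length = s + (v.length + 1) by ring]
    ring

/-- The density of the process with respect to its stationary state tends to `1`. -/
theorem Star.tendsto_density [NeZero n] (hσ : Star σ) {u : List (Fin n)} (hu : Full ∅ u) :
    Tendsto (fun s => density σ s u) atTop (𝓝 1) := by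
  set K := densityBound σ
  have hVle : ∀ L s, fullSum L ∅ (wordProb σ s) ≤ 1 := by
    intro L s
    have hmono : Monotone fun L => fullSum L ∅ (wordProb σ s) :=
      monotone_nat_of_le_succ fun L => fullSum_le_succ (wordProb_uniformTail s)
        fun u hu => wordProb_nonneg s hu
    exact hmono.ge_of_tendsto (hσ.tendsto_fullSum_wordProb s) L
  have hVge : ∀ L s, 1 - K * (1 - fullSum L ∅ (statWord σ)) ≤ fullSum L ∅ (wordProb σ s) := by
    intro L s
    have hmono : Monotone fun L => fullSum L ∅ fun u => K * statWord σ u - wordProb σ s u :=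
      monotone_nat_of_le_succ fun L => fullSum_le_succ (fun u a hu => by
        rw [statWord_uniformTail u a hu, wordProb_uniformTail s u a hu]; ring)
        fun u hu => sub_nonneg.2 (hσ.wordProb_le s hu)
    have hlim : Tendsto (fun L => fullSum L ∅ fun u => K * statWord σ u - wordProb σ s u) atTop
        (𝓝 (K * 1 - 1)) := by
      simp only [fullSum_sub, fullSum_const_mul]
      exact (hσ.tendsto_fullSum_statWord.const_mul K).sub (hσ.tendsto_fullSum_wordProb s)
    have := hmono.ge_of_tendsto hlim L
    simp only [fullSum_sub, fullSum_const_mul] at this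
    linarith
  rw [Metric.tendsto_atTop]
  intro ε hε
  -- all but little of the mass is on the full words of some length `L`, on which the densities
  -- after `s` steps approach the density of `u` after `s + L` steps
  obtain ⟨L, hL⟩ : ∃ L, K * (1 - fullSum L ∅ (statWord σ)) < ε / 3 := by
    have h := (hσ.tendsto_fullSum_statWord.const_sub 1).const_mul K
    rw [sub_self, mul_zero] at h
    exact (h.eventually_lt_const (by positivity)).exists
  have hconv : Tendsto (fun s => fullSum L ∅ fun v =>
      statWord σ v * (density σ s v - density σ (s + L) u)) atTop (𝓝 0) := by
    rw [← fullSum_zero L (∅ : Finset (Fin n))]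
    refine tendsto_fullSum fun v hvL hv => ?_
    have h := (hσ.tendsto_density_append_sub hu v).const_mul (statWord σ v)
    rw [mul_zero] at h
    refine h.congr fun s => ?_
    rw [hσ.density_append s hv, hvL]
  obtain ⟨N, hN⟩ := Metric.tendsto_atTop.1 hconv (ε / 3) (by positivity)
  refine ⟨N + L, fun t ht => ?_⟩
  obtain ⟨s, rfl⟩ : ∃ s, t = s + L := ⟨t - L, by omega⟩
  have h1 := hN s (by omega)
  have e : fullSum L ∅ (fun v => statWord σ v * (density σ s v - density σ (s + L) u)) =
      fullSum L ∅ (wordProb σ s) - density σ (s + L) u * fullSum L ∅ (statWord σ) := by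
    rw [← fullSum_const_mul, ← fullSum_sub]
    exact fullSum_congr fun v _ _ => by rw [← hσ.density_mul]; ring
  rw [e, Real.dist_eq, sub_zero, abs_lt] at h1
  have h2 := hVle L s
  have h3 := hVge L s
  have h4 : density σ (s + L) u * (1 - fullSum L ∅ (statWord σ)) ≤
      K * (1 - fullSum L ∅ (statWord σ)) :=
    mul_le_mul_of_nonneg_right (hσ.density_le _ hu) (sub_nonneg.2 (hσ.fullSum_statWord_le L))
  have h5 : 0 ≤ density σ (s + L) u * (1 - fullSum L ∅ (statWord σ)) :=
    mul_nonneg (hσ.density_nonneg _ hu) (sub_nonneg.2 (hσ.fullSum_statWord_le L))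
  rw [Real.dist_eq, abs_lt]
  constructor <;> linarith

theorem Star.tendsto_wordProb [NeZero n] (hσ : Star σ) {u : List (Fin n)} (hu : Full ∅ u) :
    Tendsto (fun s => wordProb σ s u) atTop (𝓝 (statWord σ u)) := by
  have := (hσ.tendsto_density hu).mul_const (statWord σ u)
  rw [one_mul] at this
  exact this.congr fun s => hσ.density_mul s u

end Star

/-! ### Deletions in words -/

/-- Deletes the first entry `b` of the list with `g b ∉ S` such that exactly `c` distinct letters
are in `S` or belong to an earlier entry. -/
def del {β : Type*} (g : β → Fin n) : Finset (Fin n) → ℕ → List β → List β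
  | _, _, [] => []
  | S, c, b :: l => if g b ∉ S ∧ S.card = c then l else b :: del g (insert (g b) S) c l

/-- The list that results from `s` deletions, with the choices `c 0, …, c (s - 1)`. -/
def run {β : Type*} (g : β → Fin n) (c : ℕ → Fin n) : ℕ → List β → List β
  | 0, l => l
  | s + 1, l => del g ∅ (c s) (run g c s l)

theorem del_map {β : Type*} (g : β → Fin n) (S : Finset (Fin n)) (c : ℕ) (l : List β) :
    (del g S c l).map g = del id S c (l.map g) := by
  induction l generalizing S with
  | nil => rfl
  | cons b l ih =>
    simp only [del, List.map_cons, id]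
    split_ifs
    · rfl
    · rw [List.map_cons, ih]

theorem run_map {β : Type*} (g : β → Fin n) (c : ℕ → Fin n) (s : ℕ) (l : List β) :
    (run g c s l).map g = run id c s (l.map g) := by
  induction s with
  | zero => rfl
  | succ s ih => rw [run, run, del_map, ih]

theorem del_sublist {β : Type*} (g : β → Fin n) (S : Finset (Fin n)) (c : ℕ) (l : List β) :
    (del g S c l).Sublist l := by
  induction l generalizing S with
  | nil => exact List.Sublist.refl _
  | cons b l ih =>
    simp only [del]
    split_ifs
    · exact List.sublist_cons_self b l
    · exact (ih _).cons_cons b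

theorem run_sublist {β : Type*} (g : β → Fin n) (c : ℕ → Fin n) (s : ℕ) (l : List β) :
    (run g c s l).Sublist l := by
  induction s with
  | zero => exact List.Sublist.refl _
  | succ s ih => exact (del_sublist _ _ _ _).trans ih

/-- A deletion removes the first new entry `m` that is preceded by exactly `c` distinct letters. -/
theorem del_append_cons {β : Type*} (g : β → Fin n) {S : Finset (Fin n)} {c : ℕ}
    {l₁ l₂ : List β} {m : β} (hm : g m ∉ S ∪ (l₁.map g).toFinset)
    (hc : (S ∪ (l₁.map g).toFinset).card = c) : del g S c (l₁ ++ m :: l₂) = l₁ ++ l₂ := by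
  induction l₁ generalizing S with
  | nil =>
    simp only [List.map_nil, List.toFinset_nil, union_empty] at hm hc
    simp [del, hm, hc]
  | cons b l₁ ih =>
    have e : S ∪ ((b :: l₁).map g).toFinset = insert (g b) S ∪ (l₁.map g).toFinset := by
      ext a; simp
    have hb : ¬ (g b ∉ S ∧ S.card = c) := by
      rintro ⟨hb, hS⟩
      have h1 : insert (g b) S ⊆ S ∪ ((b :: l₁).map g).toFinset := by
        rw [e]; exact subset_union_left
      have := card_le_card h1
      rw [card_insert_of_notMem hb] at this
      omega
    rw [e] at hm hc
    rw [List.cons_append, del, if_neg hb, ih hm hc, List.cons_append]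

/-- Insertions into a word happen after all letters that have been seen before the word. -/
theorem insSum_ite_eq_zero {q : Fin n} {S : Finset (Fin n)} {v w : List (Fin n)} {c : ℕ}
    (hc : c < S.card) :
    insSum q S v (fun j w' => if j = c ∧ w' = w then (1 : ℝ) else 0) = 0 := by
  induction v generalizing S w with
  | nil => rfl
  | cons b v ih =>
    have hc' : c < (insert b S).card := hc.trans_le (card_le_card (subset_insert b S))
    rw [insSum, if_neg (by omega), zero_add]
    split_ifs
    · rfl
    · cases w with
      | nil => simp [insSum_zero]
      | cons b' w =>
        by_cases hbb : b = b'
        · simpa [hbb] using ih (w := w) hc'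
        · simp [hbb, insSum_zero]

/-- A word `u` arises from `l` by a deletion if and only if `l` arises from `u` by exactly one of
the corresponding insertions. -/
theorem ite_del_eq (S : Finset (Fin n)) (c : ℕ) {l u : List (Fin n)} (hu : Full S u)
    (hl : u.length < l.length) :
    (if del id S c l = u then (1 : ℝ) else 0) =
      ∑ q ∈ Sᶜ, insSum q S u fun j w => if j = c ∧ w = l then 1 else 0 := by
  induction u generalizing S l with
  | nil =>
    have hS : S = univ := hu
    cases l with
    | nil => simp at hl
    | cons b l => simp [hS, del]
  | cons a u ih =>
    cases l with
    | nil => simp at hl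
    | cons b l =>
      have hl' : u.length < l.length := by simpa using hl
      have h := ih (insert a S) (l := l) hu hl'
      have e1 : ∑ q ∈ Sᶜ, (if S.card = c ∧ q :: a :: u = b :: l then (1 : ℝ) else 0) =
          if b ∉ S ∧ S.card = c ∧ a :: u = l then 1 else 0 := by
        by_cases hb : b ∈ S
        · rw [if_neg (by simp [hb])]
          refine Finset.sum_eq_zero fun q hq => if_neg ?_
          rintro ⟨-, h⟩
          rw [mem_compl] at hq
          exact hq ((List.cons.inj h).1 ▸ hb)
        · rw [Finset.sum_eq_single b]
          · simp [hb]
          · intro q _ hq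
            exact if_neg fun h => hq (List.cons.inj h.2).1
          · simp [hb]
      have e2 : ∑ q ∈ Sᶜ, (if a = q then (0 : ℝ) else insSum q (insert a S) u
            fun j w => if j = c ∧ a :: w = b :: l then 1 else 0) =
          if a = b then (if del id (insert a S) c l = u then 1 else 0) else 0 := by
        have e3 : ∑ q ∈ Sᶜ, (if a = q then (0 : ℝ) else insSum q (insert a S) u
            fun j w => if j = c ∧ a :: w = b :: l then 1 else 0) =
            ∑ q ∈ (insert a S)ᶜ, insSum q (insert a S) u
            fun j w => if j = c ∧ a :: w = b :: l then 1 else 0 := by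
          have : (insert a S)ᶜ = Sᶜ.filter (a ≠ ·) := by ext q; simp; tauto
          rw [this, Finset.sum_filter]
          exact Finset.sum_congr rfl fun q _ => by split_ifs <;> simp_all
        rw [e3]
        split_ifs with hab h1
        · subst hab
          rw [if_pos h1] at h
          simpa using h.symm
        · subst hab
          rw [if_neg h1] at h
          simpa using h.symm
        · simp [hab, insSum_zero]
      simp only [insSum, Finset.sum_add_distrib, e1, e2, del, id]
      by_cases hb : b ∉ S ∧ S.card = c
      · rw [if_pos hb]
        have : ¬ (a = b ∧ del id (insert a S) c l = u) := by
          rintro ⟨rfl, h2⟩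
          rw [if_pos h2] at h
          rw [Finset.sum_eq_zero fun q _ => insSum_ite_eq_zero (by
            rw [card_insert_of_notMem hb.1]; omega)] at h
          exact one_ne_zero h
        rw [← ite_and, if_neg this, add_zero]
        simp [hb.1, hb.2, eq_comm]
      · have hb' : ¬ (b ∉ S ∧ S.card = c ∧ a :: u = l) := by tauto
        rw [if_neg hb, if_neg hb', zero_add, ← ite_and]
        refine if_congr ?_ rfl rfl
        rw [List.cons.injEq]
        constructor <;> rintro ⟨rfl, h'⟩ <;> exact ⟨rfl, h'⟩

/-! ### Queues and words -/

section Dynamics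

variable {α : Type*} {x : ℕ → α}

theorem topElem_image [LinearOrder α] (hx : StrictMono x) (A : Set ℕ) :
    topElem x (x '' A) = x (sInf A) := by
  simp [topElem, hx.injective.mem_set_image]

/-- The indices in `R` of the elements in the queue named `q`, where `a` assigns the queues. -/
def queueIdx (a : ℕ → Fin n) (R : Set ℕ) (q : Fin n) : Set ℕ := {k | k ∈ R ∧ a k = q}

/-- The labelled queues `Q` consist of the elements with indices in `R`, and have their
top-elements in ascending order; the queue labelled `i` is the one named `τ i`. -/
structure IsSorted (x : ℕ → α) (a : ℕ → Fin n) (R : Set ℕ) (Q : Fin n → Set α)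
    (τ : Fin n → Fin n) : Prop where
  bijective : Function.Bijective τ
  eq_image : ∀ i, Q i = x '' queueIdx a R (τ i)
  strictMono : StrictMono fun i => sInf (queueIdx a R (τ i))

theorem exists_isSorted_relabel [LinearOrder α] (hx : StrictMono x) {a : ℕ → Fin n} {R : Set ℕ}
    (hR : ∀ q, (queueIdx a R q).Nonempty) {Q : Fin n → Set α} {τ : Fin n → Fin n}
    (hτ : Function.Bijective τ) (hQ : ∀ i, Q i = x '' queueIdx a R (τ i)) :
    ∃ τ', IsSorted x a R (relabel x Q) τ' := by
  set p := Tuple.sort fun q => topElem x (Q q)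
  have hinj : Function.Injective fun q => sInf (queueIdx a R q) := fun q q' h => by
    have h1 := (Nat.sInf_mem (hR q)).2
    have h2 := (Nat.sInf_mem (hR q')).2
    simp only at h
    rw [← h1, ← h2, h]
  have hmono : Monotone fun i => sInf (queueIdx a R (τ (p i))) := fun i j hij => by
    have h := Tuple.monotone_sort (fun q => topElem x (Q q)) hij
    simp only [Function.comp_apply, hQ, topElem_image hx] at h
    exact hx.le_iff_le.1 (by simpa only [p, hQ, topElem_image hx] using h)
  exact ⟨τ ∘ p, hτ.comp p.bijective, fun i => hQ _,
    hmono.strictMono_of_injective (hinj.comp (hτ.injective.comp p.injective))⟩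

variable {a : ℕ → Fin n} {N : ℕ} {J : List ℕ}

theorem nonempty_queueIdx (hJ : Full ∅ (J.map a)) (q : Fin n) :
    (queueIdx a {k | k ∈ J ∨ N ≤ k} q).Nonempty := by
  have h := full_iff.1 hJ q
  simp only [notMem_empty, List.mem_map, false_or] at h
  obtain ⟨k, hk, rfl⟩ := h
  exact ⟨k, Or.inl hk, rfl⟩

/-- If the elements with indices in `J` or from `N` on remain, then the top-element of the queue
labelled `i` is the first one in `J` which comes after the elements of exactly `i` queues. -/
theorem IsSorted.exists_split {Q : Fin n → Set α} {τ : Fin n → Fin n}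
    (h : IsSorted x a {k | k ∈ J ∨ N ≤ k} Q τ) (hJ : Full ∅ (J.map a))
    (hJs : J.Pairwise (· < ·)) (hJN : ∀ k ∈ J, k < N) (i : Fin n) :
    ∃ l₁ m l₂, J = l₁ ++ m :: l₂ ∧ sInf (queueIdx a {k | k ∈ J ∨ N ≤ k} (τ i)) = m ∧
      a m = τ i ∧ a m ∉ (l₁.map a).toFinset ∧ (l₁.map a).toFinset.card = (i : ℕ) := by
  set R := {k | k ∈ J ∨ N ≤ k}
  have hmem : ∀ q, sInf (queueIdx a R q) ∈ J := fun q => by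
    have h1 := full_iff.1 hJ q
    simp only [notMem_empty, List.mem_map, false_or] at h1
    obtain ⟨k, hk, hkq⟩ := h1
    have h2 : sInf (queueIdx a R q) ≤ k := Nat.sInf_le ⟨Or.inl hk, hkq⟩
    have h3 : sInf (queueIdx a R q) ∈ J ∨ N ≤ sInf (queueIdx a R q) :=
      (Nat.sInf_mem (nonempty_queueIdx hJ q)).1
    have h4 := hJN k hk
    exact h3.resolve_right fun h3 => by omega
  have hlab : ∀ q, a (sInf (queueIdx a R q)) = q := fun q =>
    (Nat.sInf_mem (nonempty_queueIdx hJ q)).2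
  obtain ⟨l₁, l₂, hl⟩ := List.append_of_mem (hmem (τ i))
  set m := sInf (queueIdx a R (τ i))
  have hlt : ∀ k, k ∈ l₁ ↔ k ∈ J ∧ k < m := by
    rw [hl, List.pairwise_append, List.pairwise_cons] at hJs
    intro k
    rw [hl, List.mem_append, List.mem_cons]
    constructor
    · exact fun hk => ⟨Or.inl hk, hJs.2.2 k hk m (List.mem_cons_self)⟩
    · rintro ⟨hk | rfl | hk, h2⟩
      · exact hk
      · omega
      · have := hJs.2.1.1 k hk
        omega
  have hset : (l₁.map a).toFinset = (Iio i).image τ := by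
    ext q
    obtain ⟨i', rfl⟩ := h.bijective.2 q
    rw [h.bijective.1.mem_finset_image, mem_Iio, ← h.strictMono.lt_iff_lt, List.mem_toFinset,
      List.mem_map]
    constructor
    · rintro ⟨k, hk, hki⟩
      rw [hlt] at hk
      exact lt_of_le_of_lt (Nat.sInf_le ⟨Or.inl hk.1, hki⟩) hk.2
    · intro h2
      exact ⟨_, (hlt _).2 ⟨hmem (τ i'), h2⟩, hlab (τ i')⟩
  refine ⟨l₁, m, l₂, hl, rfl, hlab (τ i), ?_, ?_⟩
  · rw [hset, hlab, h.bijective.1.mem_finset_image]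
    simp
  · rw [hset, card_image_of_injective _ h.bijective.1]
    simp

theorem run_range_pairwise (a c : ℕ → Fin n) (s N : ℕ) :
    (run a c s (List.range N)).Pairwise (· < ·) :=
  List.pairwise_lt_range.sublist (run_sublist a c s _)

theorem lt_of_mem_run_range {a c : ℕ → Fin n} {s N k : ℕ} (hk : k ∈ run a c s (List.range N)) :
    k < N :=
  List.mem_range.1 ((run_sublist a c s _).subset hk)

/-- As long as all queues contain one of the first `N` elements, the process is described by the
deletions from the list of these elements. -/
theorem exists_isSorted_queues [LinearOrder α] (hx : StrictMono x) (a c : ℕ → Fin n) (s N : ℕ)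
    (hfull : Full ∅ ((run a c s (List.range N)).map a)) :
    ∃ τ, IsSorted x a {k | k ∈ run a c s (List.range N) ∨ N ≤ k} (queues x a c s) τ := by
  induction s with
  | zero =>
    refine exists_isSorted_relabel hx (nonempty_queueIdx hfull) Function.bijective_id fun i => ?_
    ext y
    simp only [run, List.mem_range, queueIdx, lt_or_ge, Set.ofPred_true, Set.mem_univ, true_and]
    rfl
  | succ s ih =>
    set J := run a c s (List.range N)
    have hfull' : Full ∅ (J.map a) :=
      hfull.mono subset_rfl ((del_sublist a ∅ (c s) J).map a).subset
    obtain ⟨τ, h⟩ := ih hfull'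
    obtain ⟨l₁, m, l₂, hl, hinf, ham, hm, hcard⟩ := h.exists_split hfull'
      (run_range_pairwise a c s N) (fun k hk => lt_of_mem_run_range hk) (c s)
    have hdel : run a c (s + 1) (List.range N) = l₁ ++ l₂ := by
      have : run a c (s + 1) (List.range N) = del a ∅ (c s) J := rfl
      rw [this, hl]
      exact del_append_cons a (by simpa using hm) (by simpa using hcard)
    have hmN : m < N := lt_of_mem_run_range (c := c) (s := s) (a := a)
      (show m ∈ J by rw [hl]; simp)
    have hnodup : J.Nodup := (run_range_pairwise a c s N).imp fun h => ne_of_lt h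
    have hR : {k | k ∈ run a c (s + 1) (List.range N) ∨ N ≤ k} = {k | k ∈ J ∨ N ≤ k} \ {m} := by
      rw [hl, List.nodup_middle, List.nodup_cons] at hnodup
      ext k
      rw [hdel]
      simp only [hl, Set.mem_ofPred_eq, Set.mem_sdiff, Set.mem_singleton_iff, List.mem_append,
        List.mem_cons] at hnodup ⊢
      constructor
      · rintro (hk | hk)
        · exact ⟨by tauto, by rintro rfl; exact hnodup.1 hk⟩
        · exact ⟨Or.inr hk, by omega⟩
      · tauto
    refine exists_isSorted_relabel hx (nonempty_queueIdx hfull) h.bijective fun i => ?_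
    rw [hR]
    by_cases hi : i = c s
    · rw [hi, deleteTop, Function.update_self, h.eq_image, topElem_image hx, hinf,
        ← Set.image_singleton, ← Set.image_sdiff hx.injective]
      congr 1
      ext k
      simp only [queueIdx, Set.mem_sdiff, Set.mem_ofPred_eq]
      tauto
    · rw [deleteTop, Function.update_of_ne hi, h.eq_image]
      congr 1
      ext k
      have : a k = τ i → k ≠ m := by
        rintro hk rfl
        exact hi (h.bijective.1 (hk.symm.trans ham))
      simp only [queueIdx, Set.mem_sdiff, Set.mem_ofPred_eq, Set.mem_singleton_iff]
      tauto

/-- The rank of the top-element of the queue labelled `i` is its position in the list of remaining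
elements. -/
theorem exists_rank_queues [LinearOrder α] (hx : StrictMono x) (a c : ℕ → Fin n) (s N : ℕ)
    (hfull : Full ∅ ((run a c s (List.range N)).map a)) (i : Fin n) :
    ∃ v₁ q v₂, (run a c s (List.range N)).map a = v₁ ++ q :: v₂ ∧ q ∉ v₁.toFinset ∧
      v₁.toFinset.card = (i : ℕ) ∧ rank x (queues x a c s) i = v₁.length + 1 := by
  obtain ⟨τ, h⟩ := exists_isSorted_queues hx a c s N hfull
  set J := run a c s (List.range N)
  have hJs : J.Pairwise (· < ·) := run_range_pairwise a c s N
  obtain ⟨l₁, m, l₂, hl, hinf, ham, hm, hcard⟩ := h.exists_split hfull hJs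
    (fun k hk => lt_of_mem_run_range hk) i
  refine ⟨l₁.map a, a m, l₂.map a, by rw [hl]; simp, hm, hcard, ?_⟩
  have hmN : m < N := lt_of_mem_run_range (c := c) (s := s) (a := a)
      (show m ∈ J by rw [hl]; simp)
  have hunion : ⋃ q, queues x a c s q = x '' {k | k ∈ J ∨ N ≤ k} := by
    ext y
    simp only [Set.mem_iUnion, h.eq_image]
    constructor
    · rintro ⟨q, k, hk, rfl⟩
      exact ⟨k, hk.1, rfl⟩
    · rintro ⟨k, hk, rfl⟩
      obtain ⟨q, hq⟩ := h.bijective.2 (a k)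
      exact ⟨q, k, ⟨hk, hq.symm⟩, rfl⟩
  have hset : {y | y ∈ (⋃ q, queues x a c s q) ∧ y ≤ topElem x (queues x a c s i)} =
      x '' ((l₁ ++ [m]).toFinset : Set ℕ) := by
    rw [h.eq_image, topElem_image hx, hinf, hunion]
    ext y
    simp only [Set.mem_ofPred_eq, Set.mem_image, mem_coe, List.mem_toFinset, List.mem_append,
      List.mem_singleton]
    rw [hl, List.pairwise_append, List.pairwise_cons] at hJs
    constructor
    · rintro ⟨⟨k, hk, rfl⟩, hkm⟩
      refine ⟨k, ?_, rfl⟩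
      rw [hx.le_iff_le] at hkm
      rw [hl, List.mem_append, List.mem_cons] at hk
      rcases hk with (hk | hk | hk) | hk
      · exact Or.inl hk
      · exact Or.inr hk
      · have := hJs.2.1.1 k hk
        omega
      · omega
    · rintro ⟨k, hk, rfl⟩
      refine ⟨⟨k, Or.inl ?_, rfl⟩, hx.monotone ?_⟩
      · rw [hl, List.mem_append, List.mem_cons]; tauto
      · rcases hk with hk | rfl
        · exact (hJs.2.2 k hk m (List.mem_cons_self)).le
        · exact le_rfl
  have hnodup : (l₁ ++ [m]).Nodup := by
    have : J.Nodup := hJs.imp fun h => ne_of_lt h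
    rw [hl] at this
    exact this.sublist ((List.Sublist.refl l₁).append (by simp))
  rw [rank, hset, Set.ncard_image_of_injective _ hx.injective, Set.ncard_coe_finset,
    List.toFinset_card_of_nodup hnodup]
  simp

end Dynamics

/-- A block of `e` old letters before a new letter can be cut off. -/
theorem exists_split_of_newMask_eq {e : ℕ} {b : List Bool} {S : Finset (Fin n)} {q : Fin n}
    {v₁ v₂ : List (Fin n)} (hq : q ∉ S)
    (h : newMask S (v₁ ++ q :: v₂) = List.replicate e false ++ b) :
    ∃ v₁', v₁.length = e + v₁'.length ∧ v₁'.toFinset ⊆ v₁.toFinset ∧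
      v₁.toFinset ⊆ S ∪ v₁'.toFinset ∧ newMask S (v₁' ++ q :: v₂) = b := by
  induction e generalizing v₁ with
  | zero => exact ⟨v₁, by simp, subset_rfl, subset_union_right, h⟩
  | succ e ih =>
    cases v₁ with
    | nil => simp [newMask, hq, List.replicate_succ] at h
    | cons a v₁ =>
      simp only [List.cons_append, newMask, List.replicate_succ, List.cons.injEq,
        decide_eq_false_iff_not, not_not] at h
      rw [insert_eq_of_mem h.1] at h
      obtain ⟨v₁', h1, h2, h3, h4⟩ := ih h.2
      refine ⟨v₁', by simp [h1]; ring, h2.trans (by simp), ?_, h4⟩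
      rw [List.toFinset_cons, insert_subset_iff]
      exact ⟨mem_union_left _ h.1, h3⟩

/-- The position of a new letter is determined by the gaps before it. -/
theorem length_eq_of_newMask_eq {ds : List ℕ} {S : Finset (Fin n)} {q : Fin n} {i : ℕ}
    {v₁ v₂ : List (Fin n)} (hq : q ∉ S ∪ v₁.toFinset)
    (hi : (S ∪ v₁.toFinset).card = S.card + i)
    (h : newMask S (v₁ ++ q :: v₂) = gapMask ds) :
    v₁.length = ((ds.map (· + 1)).take i).sum := by
  induction ds generalizing S v₁ i with
  | nil =>
    cases v₁ with
    | nil =>simp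
    | cons a v₁ => cases v₁ <;> simp [newMask, gapMask] at h
  | cons e ds ih =>
    cases v₁ with
    | nil =>
      have : i = 0 := by simpa using hi
      simp [this]
    | cons a v₁ =>
      simp only [List.cons_append, newMask, gapMask, List.cons.injEq, decide_eq_true_eq] at h
      have hqS : q ∉ insert a S := by
        simp only [List.toFinset_cons, mem_union, mem_insert, not_or] at hq ⊢
        exact ⟨hq.2.1, hq.1⟩
      obtain ⟨v₁', h1, h2, h3, h4⟩ := exists_split_of_newMask_eq hqS h.2
      have e1 : insert a S ∪ v₁'.toFinset = S ∪ (a :: v₁).toFinset := by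
        ext p
        have h2' := @h2 p
        have h3' := @h3 p
        simp only [mem_union, mem_insert, List.toFinset_cons] at h3' ⊢
        tauto
      have hcard := card_insert_of_notMem h.1
      have hle : (insert a S).card ≤ S.card + i := by
        rw [← hi, ← e1]
        exact card_le_card subset_union_left
      obtain ⟨i, rfl⟩ : ∃ i', i = i' + 1 := ⟨i - 1, by omega⟩
      have := ih (S := insert a S) (i := i) (by rwa [e1]) (by rw [e1, hi, hcard]; ring) h4
      simp [h1, this]
      ring

/-! ### The law of the word of queue names -/

theorem run_congr {β : Type*} (g : β → Fin n) {c c' : ℕ → Fin n} {s : ℕ}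
    (h : ∀ t < s, c t = c' t) (l : List β) : run g c s l = run g c' s l := by
  induction s with
  | zero => rfl
  | succ s ih => rw [run, run, ih fun t ht => h t (by omega), h s (by omega)]

theorem length_le_length_run {β : Type*} (g : β → Fin n) (c : ℕ → Fin n) (s : ℕ) (l : List β) :
    l.length ≤ (run g c s l).length + s := by
  have hdel : ∀ (S : Finset (Fin n)) (c : ℕ) (l : List β), l.length ≤ (del g S c l).length + 1 := by
    intro S c l
    induction l generalizing S with
    | nil => simp
    | cons b l ih =>
      rw [del]
      split_ifs
      · rfl
      · simpa using ih (insert (g b) S)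
  induction s with
  | zero => rfl
  | succ s ih =>
    have := hdel ∅ (c s) (run g c s l)
    rw [run]
    omega

/-- The queue names of the remaining ones of the first `N` elements after `s` deletions. -/
def wordAt {Ω : Type*} (A C : ℕ → Ω → Fin n) (s N : ℕ) (ω : Ω) : List (Fin n) :=
  run id (fun t => C t ω) s ((List.range N).map fun k => A k ω)

/-- The word after `s` deletions is a function of the assignments and of the first `s` choices. -/
theorem exists_wordAt_eq [NeZero n] {Ω : Type*} (A C : ℕ → Ω → Fin n) (s N : ℕ) :
    ∃ φ : (((range N).disjSum (range s) : Finset (ℕ ⊕ ℕ)) → Fin n) → List (Fin n),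
      ∀ ω, wordAt A C s N ω = φ fun i => Sum.elim A C i ω := by
  refine ⟨fun z => run id
    (fun t => if h : Sum.inr t ∈ (range N).disjSum (range s) then z ⟨_, h⟩ else 0) s
    ((List.range N).map fun k =>
      if h : Sum.inl k ∈ (range N).disjSum (range s) then z ⟨_, h⟩ else 0), fun ω => ?_⟩
  rw [wordAt]
  have h1 : (List.range N).map (fun k => A k ω) = (List.range N).map fun k =>
      if h : Sum.inl k ∈ (range N).disjSum (range s) then Sum.elim A C (Sum.inl k) ω else 0 := by
    refine List.map_congr_left fun k hk => ?_
    rw [List.mem_range] at hk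
    rw [dif_pos (by simpa using hk)]
    rfl
  rw [h1]
  refine run_congr id (fun t ht => ?_) _
  rw [dif_pos (by simpa using ht)]
  rfl

section Law

variable {Ω : Type*} [MeasurableSpace Ω] {μ : Measure Ω}

theorem integral_insSum {q : Fin n} {S : Finset (Fin n)} {u : List (Fin n)}
    {H : Ω → ℕ → List (Fin n) → ℝ} (h : ∀ j w, Integrable (fun ω => H ω j w) μ) :
    Integrable (fun ω => insSum q S u (H ω)) μ ∧
      ∫ ω, insSum q S u (H ω) ∂μ = insSum q S u fun j w => ∫ ω, H ω j w ∂μ := by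
  induction u generalizing S H with
  | nil => simp [insSum]
  | cons a u ih =>
    by_cases ha : a = q
    · simp only [insSum, if_pos ha, add_zero]
      exact ⟨h _ _, trivial⟩
    · obtain ⟨h1, h2⟩ := ih (S := insert a S) (H := fun ω j w => H ω j (a :: w))
        fun j w => h j (a :: w)
      simp only [insSum, if_neg ha]
      exact ⟨(h _ _).add h1, by rw [integral_add (h _ _) h1, h2]⟩

theorem integral_fullSum {L : ℕ} {S : Finset (Fin n)}
    {H : Ω → List (Fin n) → ℝ} (h : ∀ w, Integrable (fun ω => H ω w) μ) :
    Integrable (fun ω => fullSum L S (H ω)) μ ∧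
      ∫ ω, fullSum L S (H ω) ∂μ = fullSum L S fun w => ∫ ω, H ω w ∂μ := by
  induction L generalizing S H with
  | zero => simp only [fullSum]; split_ifs <;> simp [h]
  | succ L ih =>
    have ih' := fun a => ih (S := insert a S) (H := fun ω u => H ω (a :: u)) fun w => h (a :: w)
    simp only [fullSum]
    refine ⟨integrable_finsetSum _ fun a _ => (ih' a).1, ?_⟩
    rw [integral_finsetSum _ fun a _ => (ih' a).1]
    exact Finset.sum_congr rfl fun a _ => (ih' a).2

theorem integral_ite_one [IsFiniteMeasure μ] {p : Ω → Prop} [DecidablePred p]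
    (hp : NullMeasurableSet {ω | p ω} μ) :
    Integrable (fun ω => if p ω then (1 : ℝ) else 0) μ ∧
      ∫ ω, (if p ω then (1 : ℝ) else 0) ∂μ = μ.real {ω | p ω} := by
  have e : (fun ω => if p ω then (1 : ℝ) else 0) = Set.indicator {ω | p ω} fun _ => 1 := by
    ext ω
    simp [Set.indicator_apply]
  rw [e]
  exact ⟨(integrable_const _).indicator₀ hp,
    by rw [integral_indicator₀ hp]; simp⟩

theorem fullSum_ite_eq_le_one (L : ℕ) (S : Finset (Fin n)) (w : List (Fin n)) :
    fullSum L S (fun u => if w = u then (1 : ℝ) else 0) ≤ 1 := by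
  induction L generalizing S w with
  | zero => simp only [fullSum]; split_ifs <;> simp
  | succ L ih =>
    cases w with
    | nil => simp [fullSum, fullSum_zero]
    | cons b w =>
      rw [fullSum, Finset.sum_eq_single b]
      · simpa using ih (insert b S) w
      · intro a _ hab
        simp [hab.symm, fullSum_zero]
      · simp

variable {A C : ℕ → Ω → Fin n}

theorem aemeasurable_elim (hA : ∀ k, AEMeasurable (A k) μ) (hC : ∀ s, AEMeasurable (C s) μ) :
    ∀ i, AEMeasurable (Sum.elim A C i) μ := by
  rintro (k | s)
  · exact hA k
  · exact hC s

theorem nullMeasurableSet_wordAt [NeZero n] (hA : ∀ k, AEMeasurable (A k) μ)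
    (hC : ∀ s, AEMeasurable (C s) μ) (s N : ℕ) (u : List (Fin n)) :
    NullMeasurableSet {ω | wordAt A C s N ω = u} μ := by
  obtain ⟨φ, hφ⟩ := exists_wordAt_eq A C s N
  have h : AEMeasurable (fun ω (i : ((range N).disjSum (range s) : Finset (ℕ ⊕ ℕ))) =>
      Sum.elim A C i ω) μ := aemeasurable_pi_lambda _ fun i => aemeasurable_elim hA hC i
  have e : {ω | wordAt A C s N ω = u} =
      (fun ω (i : ((range N).disjSum (range s) : Finset (ℕ ⊕ ℕ))) => Sum.elim A C i ω) ⁻¹'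
        (φ ⁻¹' {u}) := by
    ext ω
    simp [hφ]
  rw [e]
  exact h.nullMeasurableSet_preimage (Set.to_countable _).measurableSet

theorem measureReal_wordAt_inter [NeZero n] (hA : ∀ k, AEMeasurable (A k) μ)
    (hC : ∀ s, AEMeasurable (C s) μ)
    (h_indep : iIndepFun (Sum.elim A C) μ) (s N : ℕ)
    (u : List (Fin n)) (j : Fin n) :
    μ.real {ω | wordAt A C s N ω = u ∧ C s ω = j} =
      μ.real {ω | wordAt A C s N ω = u} * μ.real {ω | C s ω = j} := by
  obtain ⟨φ, hφ⟩ := exists_wordAt_eq A C s N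
  have hd : Disjoint ((range N).disjSum (range s) : Finset (ℕ ⊕ ℕ)) {Sum.inr s} := by simp
  have h := (h_indep.indepFun_finset₀ _ _ hd
    (aemeasurable_elim hA hC)).measure_inter_preimage_eq_mul
    (φ ⁻¹' {u}) {z | z ⟨Sum.inr s, by simp⟩ = j} (Set.to_countable _).measurableSet
    (Set.to_countable _).measurableSet
  have e1 : {ω | wordAt A C s N ω = u} =
      (fun ω (i : ((range N).disjSum (range s) : Finset (ℕ ⊕ ℕ))) => Sum.elim A C i ω) ⁻¹'
        (φ ⁻¹' {u}) := by
    ext ω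
    simp [hφ]
  have e2 : {ω | C s ω = j} =
      (fun ω (i : ({Sum.inr s} : Finset (ℕ ⊕ ℕ))) => Sum.elim A C i ω) ⁻¹'
        {z | z ⟨Sum.inr s, by simp⟩ = j} := rfl
  have e3 : {ω | wordAt A C s N ω = u ∧ C s ω = j} =
      {ω | wordAt A C s N ω = u} ∩ {ω | C s ω = j} := rfl
  rw [e3, measureReal_def, measureReal_def, measureReal_def, ← ENNReal.toReal_mul, e1, e2, h]

/-- The law of the word of queue names after `s` deletions is given by `wordProb`. -/
theorem measureReal_wordAt [NeZero n] [IsProbabilityMeasure μ] {σ : PMF (Fin n)}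
    (h_assign : ∀ k, HasLaw (A k) (PMF.uniformOfFintype (Fin n)).toMeasure μ)
    (h_choice : ∀ s, HasLaw (C s) σ.toMeasure μ) (h_indep : iIndepFun (Sum.elim A C) μ)
    (s : ℕ) {u : List (Fin n)} (hu : Full ∅ u) :
    μ.real {ω | wordAt A C s (u.length + s) ω = u} = wordProb σ s u := by
  have hA := fun k => (h_assign k).aemeasurable
  have hC := fun s => (h_choice s).aemeasurable
  induction s generalizing u with
  | zero =>
    have hind : iIndepFun A μ := h_indep.precomp (g := Sum.inl) Sum.inl_injective
    have h := hind.measure_inter_preimage_eq_mul (range u.length)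
      (sets := fun k => {u.getD k 0}) fun k _ => measurableSet_singleton _
    have e : {ω | wordAt A C 0 (u.length + 0) ω = u} =
        ⋂ k ∈ range u.length, A k ⁻¹' {u.getD k 0} := by
      ext ω
      simp only [wordAt, run, add_zero, Set.mem_ofPred_eq, Set.mem_iInter, Finset.mem_range,
        Set.mem_preimage, Set.mem_singleton_iff]
      constructor
      · intro h k hk
        have := congrArg (fun l => l.getD k 0) h
        simpa [hk] using this
      · intro h
        refine List.ext_getElem (by simp) fun k h1 h2 => ?_
        have := h k h2
        simpa [h2] using this
    have h1 : ∀ k, μ (A k ⁻¹' {u.getD k 0}) = (n : ENNReal)⁻¹ := fun k => by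
      have := (h_assign k).measure_eq (p := fun i => i = u.getD k 0)
        (measurableSet_singleton _)
      refine this.trans ?_
      rw [show {x | x = u.getD k 0} = {u.getD k 0} from rfl,
        PMF.toMeasure_apply_singleton _ _ (measurableSet_singleton _)]
      simp
    rw [e, measureReal_def, h]
    simp only [h1, Finset.prod_const, card_range, wordProb]
    simp
  | succ s ih =>
    set N := u.length + (s + 1)
    have hN : ∀ w : List (Fin n), w.length = u.length + 1 → w.length + s = N := fun w hw => by
      simp only [N]; omega
    have hmeas : ∀ (j : ℕ) (w : List (Fin n)),
        NullMeasurableSet {ω | j = (C s ω : ℕ) ∧ w = wordAt A C s N ω} μ := fun j w => by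
      have h1 := nullMeasurableSet_wordAt hA hC s N w
      have h2 := (hC s).nullMeasurableSet_preimage
        (Set.to_countable {i : Fin n | j = (i : ℕ)}).measurableSet
      have e : {ω | j = (C s ω : ℕ) ∧ w = wordAt A C s N ω} =
          C s ⁻¹' {i : Fin n | j = (i : ℕ)} ∩ {ω | wordAt A C s N ω = w} := by
        ext ω
        simp [eq_comm]
      rw [e]
      exact h2.inter h1
    have hprob : ∀ (j : ℕ) (w : List (Fin n)), w.length = u.length + 1 → Full ∅ w →
        μ.real {ω | j = (C s ω : ℕ) ∧ w = wordAt A C s N ω} = prob σ j * wordProb σ s w := by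
      intro j w hw hfull
      by_cases hj : j < n
      · have e : {ω | j = (C s ω : ℕ) ∧ w = wordAt A C s N ω} =
            {ω | wordAt A C s N ω = w ∧ C s ω = ⟨j, hj⟩} := by
          ext ω
          simp only [Set.mem_ofPred_eq, Fin.ext_iff]
          constructor <;> rintro ⟨h1, h2⟩ <;> exact ⟨h2.symm, h1.symm⟩
        rw [e, measureReal_wordAt_inter hA hC h_indep, ← ih hfull, hN w hw, mul_comm]
        congr 1
        rw [(h_choice s).measureReal_eq (p := fun i => i = ⟨j, hj⟩) (measurableSet_singleton _),
          measureReal_def, show {x : Fin n | x = ⟨j, hj⟩} = {⟨j, hj⟩} from rfl,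
          PMF.toMeasure_apply_singleton _ _ (measurableSet_singleton _), ← prob_val]
      · have e : {ω | j = (C s ω : ℕ) ∧ w = wordAt A C s N ω} = ∅ := by
          ext ω
          have := (C s ω).isLt
          simp only [Set.mem_ofPred_eq, Set.mem_empty_iff_false, iff_false, not_and]
          intro h
          omega
        rw [e, prob_of_le σ (by omega)]
        simp
    rw [← (integral_ite_one (nullMeasurableSet_wordAt hA hC (s + 1) N u)).2]
    have hpt : ∀ ω, (if wordAt A C (s + 1) N ω = u then (1 : ℝ) else 0) =
        ∑ q, insSum q ∅ u fun j w => if j = (C s ω : ℕ) ∧ w = wordAt A C s N ω then 1 else 0 := by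
      intro ω
      have hlen := length_le_length_run id (fun t => C t ω) s ((List.range N).map fun k => A k ω)
      rw [List.length_map, List.length_range] at hlen
      have := ite_del_eq ∅ (C s ω : ℕ) (l := wordAt A C s N ω) hu (by
        rw [wordAt]; simp only [N] at hlen ⊢; omega)
      rw [compl_empty] at this
      exact this
    simp only [hpt]
    have hint := fun q => integral_insSum (μ := μ) (q := q) (S := ∅) (u := u)
      (H := fun ω j w => if j = (C s ω : ℕ) ∧ w = wordAt A C s N ω then 1 else 0)
      fun j w => (integral_ite_one (hmeas j w)).1
    rw [integral_finsetSum _ fun q _ => (hint q).1]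
    refine Finset.sum_congr rfl fun q _ => ?_
    rw [(hint q).2]
    exact insSum_congr hu fun j w hw hfull => by
      rw [(integral_ite_one (hmeas j w)).2, hprob j w hw hfull]

/-- The probabilities of the words in a set add up to at most the probability of any event that
contains the corresponding events. -/
theorem fullSum_wordProb_le [NeZero n] [IsProbabilityMeasure μ] {σ : PMF (Fin n)}
    (h_assign : ∀ k, HasLaw (A k) (PMF.uniformOfFintype (Fin n)).toMeasure μ)
    (h_choice : ∀ s, HasLaw (C s) σ.toMeasure μ) (h_indep : iIndepFun (Sum.elim A C) μ)
    (s L : ℕ) (p : List (Fin n) → Prop) [DecidablePred p] {G : Set Ω}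
    (hG : NullMeasurableSet G μ)
    (h : ∀ ω u, u.length = L → Full ∅ u → p u → wordAt A C s (L + s) ω = u → ω ∈ G) :
    fullSum L ∅ (fun u => if p u then wordProb σ s u else 0) ≤ μ.real G := by
  classical
  have hA := fun k => (h_assign k).aemeasurable
  have hC := fun s => (h_choice s).aemeasurable
  have hmeas : ∀ u, NullMeasurableSet {ω | p u ∧ wordAt A C s (L + s) ω = u} μ := fun u =>
    (NullMeasurableSet.const (p u)).inter (nullMeasurableSet_wordAt hA hC s (L + s) u)
  have hint := integral_fullSum (μ := μ) (L := L) (S := ∅)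
    (H := fun ω u => if p u ∧ wordAt A C s (L + s) ω = u then 1 else 0)
    fun u => (integral_ite_one (hmeas u)).1
  have hGi := integral_ite_one (p := fun ω => ω ∈ G) hG
  have e : fullSum L ∅ (fun u => if p u then wordProb σ s u else 0) =
      ∫ ω, fullSum L ∅ (fun u => if p u ∧ wordAt A C s (L + s) ω = u then 1 else 0) ∂μ := by
    rw [hint.2]
    refine fullSum_congr fun u hL hu => ?_
    rw [(integral_ite_one (hmeas u)).2, ← measureReal_wordAt h_assign h_choice h_indep s hu, hL]
    split_ifs with hp <;> simp [hp]
  rw [e, show μ.real G = ∫ ω, (if ω ∈ G then (1 : ℝ) else 0) ∂μ from hGi.2.symm]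
  refine integral_mono hint.1 hGi.1 fun ω => ?_
  simp only
  split_ifs with hω
  · refine le_trans (fullSum_mono fun u _ _ => ?_) (fullSum_ite_eq_le_one L ∅
      (wordAt A C s (L + s) ω))
    split_ifs <;> first | tauto | simp
  · refine ((fullSum_congr (G := fun _ => 0) fun u hL hu => if_neg ?_).trans
      (fullSum_zero L _)).le
    exact fun h1 => hω (h ω u hL hu h1.1 h1.2)

end Law

/-! ### The law of the ranks -/

/-- In a word, there is only one new letter which is preceded by a given number of distinct
letters. -/
theorem length_eq_of_card_eq {v₁ v₂ w₁ w₂ : List (Fin n)} {q r : Fin n}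
    (h : v₁ ++ q :: v₂ = w₁ ++ r :: w₂) (hq : q ∉ v₁.toFinset) (hr : r ∉ w₁.toFinset)
    (hcard : v₁.toFinset.card = w₁.toFinset.card) : v₁.length = w₁.length := by
  have key : ∀ {v w : List (Fin n)} {q : Fin n}, q ∉ v.toFinset →
      v.toFinset.card = (v ++ q :: w).toFinset.card → False := by
    intro v w q hq hc
    have h1 : insert q v.toFinset ⊆ (v ++ q :: w).toFinset := by
      intro p
      simp only [mem_insert, List.mem_toFinset, List.mem_append, List.mem_cons]
      tauto
    have h2 := card_le_card h1
    rw [card_insert_of_notMem hq] at h2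
    omega
  rcases List.append_eq_append_iff.1 h with ⟨l, rfl, hl⟩ | ⟨l, rfl, hl⟩
  · cases l with
    | nil => simp
    | cons p l =>
      obtain ⟨rfl, -⟩ := List.cons.inj hl
      exact (key hq hcard).elim
  · cases l with
    | nil => simp
    | cons p l =>
      obtain ⟨rfl, -⟩ := List.cons.inj hl
      exact (key hr hcard.symm).elim

section Ranks

variable {α : Type*} [LinearOrder α] {x : ℕ → α} {Ω : Type*} {A C : ℕ → Ω → Fin n}

/-- The ranks of the top-elements after `s` deletions. -/
noncomputable def rankAt (x : ℕ → α) (A C : ℕ → Ω → Fin n) (s : ℕ) (ω : Ω) (i : Fin n) : ℕ :=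
  rank x (queues x (fun k => A k ω) (fun t => C t ω) s) i

theorem exists_rankAt (hx : StrictMono x) {s N : ℕ} {ω : Ω} (h : Full ∅ (wordAt A C s N ω))
    (i : Fin n) :
    ∃ v₁ q v₂, wordAt A C s N ω = v₁ ++ q :: v₂ ∧ q ∉ v₁.toFinset ∧
      v₁.toFinset.card = (i : ℕ) ∧ rankAt x A C s ω i = v₁.length + 1 := by
  have e : wordAt A C s N ω = (run (fun k => A k ω) (fun t => C t ω) s (List.range N)).map
      fun k => A k ω := (run_map _ _ _ _).symm
  rw [e] at h ⊢
  exact exists_rank_queues hx _ _ s N h i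

theorem rankAt_eq_of_wordAt_eq (hx : StrictMono x) {s N : ℕ} {ω ω' : Ω}
    (h : Full ∅ (wordAt A C s N ω)) (h' : wordAt A C s N ω' = wordAt A C s N ω) :
    rankAt x A C s ω' = rankAt x A C s ω := by
  ext i
  obtain ⟨v₁, q, v₂, h1, h2, h3, h4⟩ := exists_rankAt (x := x) hx h i
  obtain ⟨w₁, r, w₂, h1', h2', h3', h4'⟩ := exists_rankAt (x := x) hx (h'.symm ▸ h) i
  rw [h4, h4', length_eq_of_card_eq (h1.symm.trans (h'.symm.trans h1')) h2 h2' (h3.trans h3'.symm)]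

/-- The ranks `1 + ∑ j < i, (d j + 1)` with gaps `d j + 1`. -/
def gapRanks (d : Fin (n - 1) → ℕ) (i : Fin n) : ℕ :=
  1 + ∑ j : Fin (n - 1) with j.val < i.val, (d j + 1)

theorem gapRanks_injective : Function.Injective (gapRanks (n := n)) := by
  intro d d' h
  ext j
  have hj := j.isLt
  have hs : univ.filter (fun k : Fin (n - 1) => k.val < j.val + 1) =
      insert j (univ.filter fun k : Fin (n - 1) => k.val < j.val) := by
    ext k
    simp only [mem_filter, mem_univ, true_and, mem_insert, Fin.ext_iff]
    omega
  have h1 := congrFun h ⟨j, by omega⟩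
  have h2 := congrFun h ⟨j + 1, by omega⟩
  simp only [gapRanks, hs] at h1 h2
  rw [Finset.sum_insert (by simp), Finset.sum_insert (by simp)] at h2
  omega

/-- The mask of a full prefix of the word determines the ranks. -/
theorem rankAt_eq_gapRanks (hx : StrictMono x) {s N : ℕ} {ω : Ω}
    (h : Full ∅ (wordAt A C s N ω)) {d : Fin (n - 1) → ℕ}
    (hd : newMask ∅ (wordAt A C s N ω) = gapMask (List.ofFn d)) :
    rankAt x A C s ω = gapRanks d := by
  ext i
  obtain ⟨v₁, q, v₂, h1, h2, h3, h4⟩ := exists_rankAt (x := x) hx h i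
  rw [h1] at hd
  have := length_eq_of_newMask_eq (S := ∅) (i := i) (by simpa using h2) (by simpa using h3) hd
  rw [h4, this, List.map_ofFn, List.sum_take_ofFn, gapRanks, add_comm]
  rfl

variable [MeasurableSpace Ω] {μ : Measure Ω} [IsProbabilityMeasure μ] [NeZero n]
  {σ : PMF (Fin n)}

theorem aemeasurable_rankAt (hσ : Star σ) (hx : StrictMono x)
    (h_assign : ∀ k, HasLaw (A k) (PMF.uniformOfFintype (Fin n)).toMeasure μ)
    (h_choice : ∀ s, HasLaw (C s) σ.toMeasure μ) (h_indep : iIndepFun (Sum.elim A C) μ)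
    (s : ℕ) : AEMeasurable (rankAt x A C s) μ := by
  have hA := fun k => (h_assign k).aemeasurable
  have hC := fun s => (h_choice s).aemeasurable
  -- almost surely, all queues contain one of the first elements, and then finitely many of the
  -- random variables determine the ranks
  set E : {u : List (Fin n) // Full ∅ u} → Set Ω :=
    fun u => {ω | wordAt A C s (u.1.length + s) ω = u.1}
  have hE : ∀ u, NullMeasurableSet (E u) μ := fun u => nullMeasurableSet_wordAt hA hC _ _ _
  have hU : NullMeasurableSet (⋃ u, E u) μ := NullMeasurableSet.iUnion hE
  have hone : 1 ≤ μ.real (⋃ u, E u) := by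
    refine le_of_tendsto' (hσ.tendsto_fullSum_wordProb s) fun L => ?_
    have := fullSum_wordProb_le h_assign h_choice h_indep s L (fun _ => True) hU
      fun ω u hL hu _ hω => Set.mem_iUnion.2 ⟨⟨u, hu⟩, by
        simp only [E, Set.mem_ofPred_eq]
        rwa [hL]⟩
    simpa using this
  have hfull : μ (⋃ u, E u) = 1 := by
    have h1 : μ.real (⋃ u, E u) = 1 := le_antisymm measureReal_le_one hone
    rw [measureReal_def] at h1
    exact (ENNReal.toReal_eq_one_iff _).1 h1
  have hae : (⋃ u, E u) =ᵐ[μ] Set.univ := by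
    rw [eventuallyEq_univ, mem_ae_iff]
    exact (prob_compl_eq_zero_iff₀ hU).2 hfull
  rw [← Measure.restrict_univ (μ := μ), ← Measure.restrict_congr_set hae, aemeasurable_iUnion_iff]
  intro u
  by_cases hne : (E u).Nonempty
  · obtain ⟨ω₀, hω₀⟩ := hne
    have hω₀' : wordAt A C s (u.1.length + s) ω₀ = u.1 := hω₀
    refine (aemeasurable_const (b := rankAt x A C s ω₀)).congr ?_
    refine (ae_restrict_iff'₀ (hE u)).2 (Eventually.of_forall fun ω hω => ?_)
    exact (rankAt_eq_of_wordAt_eq hx (hω₀'.symm ▸ u.2)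
      ((show wordAt A C s (u.1.length + s) ω = u.1 from hω).trans hω₀'.symm)).symm
  · rw [Set.not_nonempty_iff_eq_empty.1 hne, Measure.restrict_empty]
    exact aemeasurable_zero_measure

/-- The probability that the stationary process has the gaps `d j + 1`. -/
noncomputable def gapProb (σ : PMF (Fin n)) (d : Fin (n - 1) → ℕ) : ℝ :=
  ∏ j : Fin (n - 1), ((j + 1 : ℕ) * oldWeight σ (j + 1)) ^ d j *
    (1 - (j + 1 : ℕ) * oldWeight σ (j + 1))

/-- The probability of given gaps is asymptotically at least the one in the stationary state. -/
theorem exists_tendsto_gapProb (hσ : Star σ) (hx : StrictMono x)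
    (h_assign : ∀ k, HasLaw (A k) (PMF.uniformOfFintype (Fin n)).toMeasure μ)
    (h_choice : ∀ s, HasLaw (C s) σ.toMeasure μ) (h_indep : iIndepFun (Sum.elim A C) μ)
    (d : Fin (n - 1) → ℕ) :
    ∃ l : ℕ → ℝ, Tendsto l atTop (𝓝 (gapProb σ d)) ∧
      ∀ s, l s ≤ μ.real {ω | rankAt x A C s ω = gapRanks d} := by
  set b := gapMask (List.ofFn d)
  have hn : 0 < n := NeZero.pos n
  refine ⟨fun s => fullSum b.length ∅ fun u => if newMask ∅ u = b then wordProb σ s u else 0,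
    ?_, fun s => ?_⟩
  · have h1 : gapProb σ d = fullSum b.length ∅ fun u =>
        if newMask ∅ u = b then statWord σ u else 0 := by
      have h2 := fullSum_mask (oldWeight σ) (newWeight σ) b (∅ : Finset (Fin n))
      rw [card_empty, maskWeight_gapMask _ _ (by omega)] at h2
      have h3 := sub_mul_newWeight (σ := σ) hn
      rw [h3] at h2
      refine Eq.trans ?_ h2.symm
      simp only [gapProb, Nat.cast_zero, zero_mul, sub_zero, one_mul, zero_add]
      refine Finset.prod_congr rfl fun j _ => ?_
      have hj := j.isLt
      have h4 := sub_mul_newWeight (σ := σ) (j := 1 + j) (by omega)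
      rw [h4, add_comm]
    rw [h1]
    refine tendsto_fullSum fun u _ hu => ?_
    split_ifs
    · exact hσ.tendsto_wordProb hu
    · exact tendsto_const_nhds
  · refine fullSum_wordProb_le h_assign h_choice h_indep s b.length (fun u => newMask ∅ u = b) ?_
      fun ω u hL hu hub hω => ?_
    · exact (aemeasurable_rankAt hσ hx h_assign h_choice h_indep s).nullMeasurableSet_preimage
        (measurableSet_singleton (gapRanks d))
    · exact rankAt_eq_gapRanks hx (hω.symm ▸ hu) (by rw [hω]; exact hub)

end Ranks

/-- Asymptotic lower bounds for the probabilities of the values of a discrete limit suffice for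
the convergence in distribution. -/
theorem tendstoInDistribution_of_tendsto_le {E : Type*} [TopologicalSpace E] [MeasurableSpace E]
    [OpensMeasurableSpace E] [HasOuterApproxClosed E] [MeasurableSingletonClass E]
    {Ω : Type*} [MeasurableSpace Ω] {μ : Measure Ω} [IsProbabilityMeasure μ]
    {Ω' : Type*} [MeasurableSpace Ω'] [Countable Ω'] [MeasurableSingletonClass Ω']
    {μ' : Measure Ω'} [IsProbabilityMeasure μ'] {X : ℕ → Ω → E} {Z : Ω' → E}
    (hX : ∀ s, AEMeasurable (X s) μ) (hZ : Function.Injective Z)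
    (h : ∀ z, ∃ l : ℕ → ℝ, Tendsto l atTop (𝓝 (μ'.real {z})) ∧
      ∀ s, l s ≤ μ.real {ω | X s ω = Z z}) :
    TendstoInDistribution X atTop Z (fun _ => μ) μ' := by
  have hZm : Measurable Z := measurable_of_countable Z
  refine ⟨hX, hZm.aemeasurable, tendsto_of_forall_isOpen_le_liminf' fun G hG => ?_⟩
  choose l hl hle using h
  simp only [ProbabilityMeasure.coe_mk]
  rw [Measure.map_apply hZm hG.measurableSet, ← Measure.tsum_indicator_apply_singleton μ' _
    (hZm hG.measurableSet), ENNReal.tsum_eq_iSup_sum]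
  refine iSup_le fun F => ?_
  classical
  set F' := F.filter fun z => Z z ∈ G
  have hF : ∑ z ∈ F, (Z ⁻¹' G).indicator (fun z => μ' {z}) z = ∑ z ∈ F', μ' {z} := by
    simp [F', Set.indicator_apply, Finset.sum_filter]
  have hlim : Tendsto (fun s => ENNReal.ofReal (∑ z ∈ F', l z s)) atTop
      (𝓝 (∑ z ∈ F', μ' {z})) := by
    have h1 : ∑ z ∈ F', μ' {z} = ENNReal.ofReal (∑ z ∈ F', μ'.real {z}) := by
      rw [ENNReal.ofReal_sum_of_nonneg fun _ _ => measureReal_nonneg]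
      exact Finset.sum_congr rfl fun z _ => by simp [measureReal_def]
    rw [h1]
    exact ENNReal.tendsto_ofReal (tendsto_finsetSum _ fun z _ => hl z)
  rw [hF, ← hlim.liminf_eq]
  refine liminf_le_liminf (Eventually.of_forall fun s => ?_)
  rw [Measure.map_apply_of_aemeasurable (hX s) hG.measurableSet]
  calc ENNReal.ofReal (∑ z ∈ F', l z s)
      ≤ ENNReal.ofReal (∑ z ∈ F', μ.real {ω | X s ω = Z z}) :=
        ENNReal.ofReal_le_ofReal (Finset.sum_le_sum fun z _ => hle z s)
    _ = ∑ z ∈ F', μ {ω | X s ω = Z z} := by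
        rw [ENNReal.ofReal_sum_of_nonneg fun _ _ => measureReal_nonneg]
        exact Finset.sum_congr rfl fun z _ => by simp [measureReal_def]
    _ = μ (⋃ z ∈ F', {ω | X s ω = Z z}) := by
        refine (measure_biUnion_finset₀ (fun z _ z' _ hzz => ?_) fun z _ => ?_).symm
        · refine Disjoint.aedisjoint (Set.disjoint_left.2 fun ω h1 h2 => ?_)
          exact hzz (hZ ((show X s ω = Z z from h1).symm.trans h2))
        · exact (hX s).nullMeasurableSet_preimage (measurableSet_singleton (Z z))
    _ ≤ μ (X s ⁻¹' G) := by
        refine measure_mono (Set.iUnion₂_subset fun z hz ω hω => ?_)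
        have h1 : X s ω = Z z := hω
        have h2 : Z z ∈ G := (Finset.mem_filter.1 hz).2
        rw [Set.mem_preimage, h1]
        exact h2

end SigmaMultiQueue

theorem theorem1 {n : ℕ} [NeZero n] (σ : PMF (Fin n)) (hσ : Star σ)
    -- the elements `x 0 < x 1 < x 2 < …`
    {α : Type*} [LinearOrder α] (x : ℕ → α) (hx : StrictMono x)
    -- the random initial queue `assign k` of each `x k`, and the random choices for the deletions
    {Ω : Type*} [MeasurableSpace Ω] (μ : Measure Ω) [IsProbabilityMeasure μ]
    (assign choice : ℕ → Ω → Fin n)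
    (h_assign : ∀ k, HasLaw (assign k) (PMF.uniformOfFintype (Fin n)).toMeasure μ)
    (h_choice : ∀ s, HasLaw (choice s) σ.toMeasure μ)
    (h_indep : iIndepFun (Sum.elim assign choice) μ) :
    ∃ (Ω' : Type) (_ : MeasurableSpace Ω') (μ' : Measure Ω') (_ : IsProbabilityMeasure μ')
      (δ : Fin (n - 1) → Ω' → ℕ),
      iIndepFun δ μ' ∧
      (∀ j : Fin (n - 1), ∃ p : unitInterval,
        (p : ℝ) = 1 - ((j.val + 1 : ℕ) : ℝ) / (n * cumul σ (j.val + 1)) ∧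
        HasLaw (δ j) (geomOne p) μ') ∧
      TendstoInDistribution
        (fun (s : ℕ) (ω : Ω) (i : Fin n) =>
          rank x (queues x (fun k => assign k ω) (fun t => choice t ω) s) i)
        atTop
        (fun (ω' : Ω') (i : Fin n) => 1 + ∑ j : Fin (n - 1) with j.val < i.val, δ j ω')
        (fun _ => μ) μ' := by
  have hlt : ∀ j : Fin (n - 1), ((j.val + 1 : ℕ) : ℝ) * oldWeight σ (j.val + 1) < 1 := fun j =>
    hσ.mul_oldWeight_lt (by have := j.isLt; omega)
  have hnonneg : ∀ j : Fin (n - 1), 0 ≤ ((j.val + 1 : ℕ) : ℝ) * oldWeight σ (j.val + 1) := fun j =>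
    mul_nonneg (Nat.cast_nonneg _) (oldWeight_nonneg σ _)
  let p : Fin (n - 1) → unitInterval := fun j =>
    ⟨1 - ((j.val + 1 : ℕ) : ℝ) * oldWeight σ (j.val + 1),
      sub_nonneg.2 (hlt j).le, sub_le_self _ (hnonneg j)⟩
  have hp0 : ∀ j, p j ≠ 0 := fun j h => by
    have h1 := congrArg (fun q : unitInterval => (q : ℝ)) h
    simp only [p, Set.Icc.coe_zero] at h1
    linarith [hlt j]
  -- the coordinates count the failures, of which there is one less than trials
  refine ⟨Fin (n - 1) → ℕ, inferInstance, Measure.pi fun j => geometricMeasure (p j),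
    inferInstance, fun j d => d j + 1, ?_, fun j => ⟨p j, ?_, ?_⟩, ?_⟩
  · exact iIndepFun_pi (X := fun _ k => k + 1) fun j => (measurable_of_countable _).aemeasurable
  · simp only [p, oldWeight, mul_one_div]
  · exact ⟨(measurable_of_countable _).aemeasurable, by
      rw [geomOne, ← (measurePreserving_eval (fun j => geometricMeasure (p j)) j).map_eq]
      exact (Measure.map_map (measurable_of_countable _) (measurable_pi_apply j)).symm⟩
  · refine tendstoInDistribution_of_tendsto_le (Z := gapRanks)
      (aemeasurable_rankAt hσ hx h_assign h_choice h_indep) gapRanks_injective fun d => ?_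
    have e : (Measure.pi fun j => geometricMeasure (p j)).real {d} = gapProb σ d := by
      rw [measureReal_def, Measure.pi_singleton, ENNReal.toReal_prod, gapProb]
      refine Finset.prod_congr rfl fun j _ => ?_
      rw [← measureReal_def, geometricMeasure_real_singleton (hp0 j)]
      simp only [p, sub_sub_cancel]
    rw [e]
    exact exists_tendsto_gapProb hσ hx h_assign h_choice h_indep d
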